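/- Let $\mathsf X,\mathsf Y$ be Polish spaces. Consider a state space model with initial distribution $\chi$ on $\mathsf X$, transition kernel $M(x,\mathrm dx')=m(x,x')\,\nu(\mathrm dx')$ for a $\sigma$-finite measure $\nu$ on $\mathsf X$, and observation density $g(x,y)$ with respect to a $\sigma$-finite measure on $\mathsf Y$. Fix observations $(y_t)_{t\ge 0}$ and write $g_t(x)=g(x,y_t)$. For $s\le T$ and bounded measurable $h:\mathsf X\to\mathbb R$, the marginal smoothing distribution is $$\phi_{s|T}(h)=\frac{\int\cdots\int \chi(\mathrm dx_0)\,g_0(x_0)\prod_{u=1}^T M(x_{u-1},\mathrm dx_u)\,g_u(x_u)\,h(x_s)}{\int\cdots\int \chi(\mathrm dx_0)\,g_0(x_0)\prod_{u=1}^T M(x_{u-1},\mathrm dx_u)\,g_u(x_u)} .$$ *Auxiliary particle filter.* Let $\rho_0$ be a probability measure with $\chi\ll\rho_0$ (and fix a version of $\mathrm d\chi/\mathrm d\rho_0$), and, for $t\ge1$, let $\vartheta_t\ge 0$ be adjustment multiplier functions and $P_t(x,\mathrm dx')=p_t(x,x')\,\nu(\mathrm dx')$ Markov proposal kernels. Put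 $\omega_0(x)=\frac{\mathrm d\chi}{\mathrm d\rho_0}(x)\,g_0(x)$ and $\omega_t(x,x')=\frac{m(x,x')g_t(x')}{\vartheta_t(x)p_t(x,x')}$ for $t\ge1$. For $N\ge1$, the particles $\xi_0^1,\dots,\xi_0^N$ are i.i.d. from $\rho_0$ with weights $\omega_0^i=\omega_0(\xi_0^i)$. For $t\ge1$, given the $\sigma$-algebra $\mathcal F_{t-1}^N$ generated by the particles and weights up to time $t-1$, the pairs $(I_t^i,\xi_t^i)$, $1\le i\le N$, are i.i.d. from the distribution on $\{1,\dots,N\}\times\mathsf X$ proportional to $(i,\mathrm dx)\mapsto\omega_{t-1}^i\vartheta_t(\xi_{t-1}^i)P_t(\xi_{t-1}^i,\mathrm dx)$, and $\omega_t^i=\omega_t(\xi_{t-1}^{I_t^i},\xi_t^i)$. It is understood that $\sum_i\omega_t^i>0$ almost surely, so that the algorithm is well defined. Let $\hat\phi_t=\sum_i\omega_t^i\delta_{\xi_t^i}/\sum_j\omega_t^j$. *Estimators.* For a probability measure $\eta$ put $B_\eta(x,h)=\int\eta(\mathrm dx')m(x',x)h(x')/\int\eta(\mathrm dx')m(x',x)$.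 The FFBS (FFBSm) estimator is $$\hat\phi_{s|T}(h)=\int\cdots\int\hat\phi_T(\mathrm dx_T)\,B_{\hat\phi_{T-1}}(x_T,\mathrm dx_{T-1})\cdots B_{\hat\phi_s}(x_{s+1},\mathrm dx_s)\,h(x_s).$$ The FFBSi estimator is $\tilde\phi_{s|T}(h)=N^{-1}\sum_{\ell=1}^N h\bigl(\xi_s^{J_s^\ell}\bigr)$, where, conditionally on $\mathcal F_T^N$, the index paths $J_{0:T}^1,\dots,J_{0:T}^N$ are i.i.d. with $$\mathbb P[J_{0:T}=j_{0:T}\mid\mathcal F_T^N]=\frac{\omega_T^{j_T}}{\sum_i\omega_T^i}\prod_{t=0}^{T-1}\frac{\omega_t^{j_t}\,m(\xi_t^{j_t},\xi_{t+1}^{j_{t+1}})}{\sum_{l}\omega_t^{l}\,m(\xi_t^{l},\xi_{t+1}^{j_{t+1}})} .$$ *Theorem.* Assume: 1. $g_t>0$ for all $t\ge0$ and $\sup_{t\ge0}\sup_x g_t(x)<\infty$; 2. $\sup_{t\ge1}\sup_x\vartheta_t(x)<\infty$, $\sup_x\omega_0(x)<\infty$ and $\sup_{t\ge1}\sup_{x,x'}\omega_t(x,x')<\infty$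 (a zero denominator giving $\omega_t=\infty$); 3. there are $0<\sigma_-\le\sigma_+<\infty$ with $\sigma_-\le m(x,x')\le\sigma_+$ for all $x,x'$, and $c_->0$ with $\int\chi(\mathrm dx)g_0(x)\ge c_-$ and $\inf_x\int M(x,\mathrm dx')g_t(x')\ge c_-$ for all $t\ge1$. Then there exist constants $0<B,C<\infty$ such that for all integers $N\ge1$ and $0\le s\le T$, all bounded measurable $h:\mathsf X\to\mathbb R$ and all $\epsilon>0$, $$\mathbb P\bigl[|\hat\phi_{s|T}(h)-\phi_{s|T}(h)|\ge\epsilon\bigr]\le B\,e^{-CN\epsilon^2/\operatorname{osc}(h)^2},\qquad \mathbb P\bigl[|\tilde\phi_{s|T}(h)-\phi_{s|T}(h)|\ge\epsilon\bigr]\le B\,e^{-CN\epsilon^2/\operatorname{osc}(h)^2},$$ where $\operatorname{osc}(h)=\sup_{x,x'}|h(x)-h(x')|$ and the bounds are read as $0$ if $\operatorname{osc}(h)=0$. -/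

import Mathlib

open MeasureTheory ProbabilityTheory
open scoped ENNReal NNReal

namespace ParticleSmoothing

noncomputable section

universe u v w

/-- A fully dominated state space model: initial law `χ`, transition kernel `M` with density `m`
with respect to the `σ`-finite measure `ν`, and an observation density `g(x, ·)` with respect to
the `σ`-finite measure `lam`. -/
structure StateSpaceModel (X : Type u) (Y : Type v) [MeasurableSpace X] [MeasurableSpace Y] where
  χ : Measure X
  isProb_χ : IsProbabilityMeasure χ
  ν : Measure X
  sigmaFinite_ν : SigmaFinite ν
  M : Kernel X X
  isMarkov_M : IsMarkovKernel M
  m : X → X → ℝ≥0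
  measurable_m : Measurable (Function.uncurry m)
  M_eq : ∀ x, M x = ν.withDensity (fun x' => (m x x' : ℝ≥0∞))
  lam : Measure Y
  sigmaFinite_lam : SigmaFinite lam
  g : X → Y → ℝ≥0
  measurable_g : Measurable (Function.uncurry g)
  lintegral_g : ∀ x, ∫⁻ y, (g x y : ℝ≥0∞) ∂lam = 1

attribute [instance] StateSpaceModel.isProb_χ StateSpaceModel.sigmaFinite_ν
  StateSpaceModel.isMarkov_M StateSpaceModel.sigmaFinite_lam

/-- The design parameters of an auxiliary particle filter for the model `S`: the instrumental
initial law `ρ₀` with a version `r` of `dχ/dρ₀`, and, for the times `t ≥ 1`, the adjustment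
multiplier functions `ϑ t` and the Markovian proposal kernels `P t` with `ν`-densities `p t`
(the entries of `ϑ`, `P`, `p` at time `0` are never used). -/
structure FilterDesign {X : Type u} {Y : Type v} [MeasurableSpace X] [MeasurableSpace Y]
    (S : StateSpaceModel X Y) where
  ρ₀ : Measure X
  isProb_ρ₀ : IsProbabilityMeasure ρ₀
  r : X → ℝ≥0
  measurable_r : Measurable r
  χ_eq : S.χ = ρ₀.withDensity (fun x => (r x : ℝ≥0∞))
  ϑ : ℕ → X → ℝ≥0
  measurable_ϑ : ∀ t, Measurable (ϑ t)
  P : ℕ → Kernel X X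
  isMarkov_P : ∀ t, IsMarkovKernel (P t)
  p : ℕ → X → X → ℝ≥0
  measurable_p : ∀ t, Measurable (Function.uncurry (p t))
  P_eq : ∀ t x, P t x = S.ν.withDensity (fun x' => (p t x x' : ℝ≥0∞))

attribute [instance] FilterDesign.isProb_ρ₀ FilterDesign.isMarkov_P

/-- The oscillation `sup_{x, x'} |h x - h x'|` (used for bounded `h` only). -/
def osc {X : Type u} (h : X → ℝ) : ℝ := ⨆ z : X × X, |h z.1 - h z.2|

/-- `B exp(-C N ε² / o²)`, which is read as `0` when `o = 0`. -/
def hoeffdingBound (B C : ℝ) (N : ℕ) (ε o : ℝ) : ℝ :=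
  if o = 0 then 0 else B * Real.exp (-(C * N * ε ^ 2 / o ^ 2))

/-- Conditionally on the sub-`σ`-algebra `F`, the random element `Z` has the (random) law `κ`. -/
structure HasCondLaw {Ω : Type w} {E : Type u} [mΩ : MeasurableSpace Ω] [MeasurableSpace E]
    (μ : Measure Ω) (F : MeasurableSpace Ω) (Z : Ω → E) (κ : Ω → Measure E) : Prop where
  le : F ≤ mΩ
  measurable_law : ∀ D : Set E, MeasurableSet D → Measurable[F] (fun ω => κ ω D)
  law_eq : ∀ A : Set Ω, MeasurableSet[F] A → ∀ D : Set E, MeasurableSet D →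
    μ (A ∩ Z ⁻¹' D) = ∫⁻ ω in A, κ ω D ∂μ

section Model

variable {X : Type u} {Y : Type v} [MeasurableSpace X] [MeasurableSpace Y]

/-- The law of `(X_0, …, X_n)`. -/
def StateSpaceModel.pathMeasure (S : StateSpaceModel X Y) : (n : ℕ) → Measure (Fin (n + 1) → X)
  | 0 => S.χ.map (fun x _ => x)
  | n + 1 =>
    ((S.pathMeasure n).compProd
      (S.M.comap (fun x : Fin (n + 1) → X => x (Fin.last n)) (measurable_pi_apply _))).map
      (fun z => Fin.snoc (α := fun _ => X) z.1 z.2)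

/-- The joint smoothing distribution `φ_{0:T|T}(H)`: the posterior expectation of `H(X_{0:T})`
given the observations `y_0, …, y_T`. -/
def StateSpaceModel.jointSmoothing (S : StateSpaceModel X Y) (y : ℕ → Y) (T : ℕ)
    (H : (Fin (T + 1) → X) → ℝ) : ℝ :=
  (∫ x, (∏ u : Fin (T + 1), (S.g (x u) (y u) : ℝ)) * H x ∂(S.pathMeasure T)) /
    (∫ x, (∏ u : Fin (T + 1), (S.g (x u) (y u) : ℝ)) ∂(S.pathMeasure T))

/-- The marginal smoothing distribution `φ_{s|T}(h)`. -/
def StateSpaceModel.smoothing (S : StateSpaceModel X Y) (y : ℕ → Y) (T : ℕ) (s : Fin (T + 1))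
    (h : X → ℝ) : ℝ :=
  S.jointSmoothing y T (fun x => h (x s))

/-- The backward kernel `B_η(x, h) = ∫ η(dx') m(x', x) h(x') / ∫ η(dx') m(x', x)`. -/
def StateSpaceModel.backwardKernel (S : StateSpaceModel X Y) (η : Measure X) (h : X → ℝ)
    (x : X) : ℝ :=
  (∫ x', (S.m x' x : ℝ) * h x' ∂η) / (∫ x', (S.m x' x : ℝ) ∂η)

/-- For a flow `η_0, η_1, …` of probability measures, the function
`x_{s+n} ↦ ∫ ⋯ ∫ B_{η_{s+n-1}}(x_{s+n}, dx_{s+n-1}) ⋯ B_{η_s}(x_{s+1}, dx_s) h(x_s)`. -/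
def StateSpaceModel.backwardIter (S : StateSpaceModel X Y) (η : ℕ → Measure X) (s : ℕ)
    (h : X → ℝ) : ℕ → X → ℝ
  | 0 => h
  | n + 1 => S.backwardKernel (η (s + n)) (S.backwardIter η s h n)

/-- Positive likelihoods, bounded uniformly in time. -/
def StateSpaceModel.BoundedLikelihood (S : StateSpaceModel X Y) (y : ℕ → Y) : Prop :=
  (∀ t x, 0 < S.g x (y t)) ∧ (⨆ t, ⨆ x, (S.g x (y t) : ℝ≥0∞)) < ⊤

/-- The strong mixing condition, with lower bounds on the predictive likelihoods. -/
def StateSpaceModel.StrongMixing (S : StateSpaceModel X Y) (y : ℕ → Y) : Prop :=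
  (∃ σm σp : ℝ≥0, 0 < σm ∧ σm ≤ σp ∧ ∀ x x', σm ≤ S.m x x' ∧ S.m x x' ≤ σp) ∧
  ∃ c : ℝ≥0, 0 < c ∧ (c : ℝ≥0∞) ≤ ∫⁻ x, (S.g x (y 0) : ℝ≥0∞) ∂S.χ ∧
    ∀ t, 1 ≤ t → (c : ℝ≥0∞) ≤ ⨅ x, ∫⁻ x', (S.g x' (y t) : ℝ≥0∞) ∂(S.M x)

variable {S : StateSpaceModel X Y}

/-- The importance weight function at time `0`. -/
def FilterDesign.weightFn₀ (A : FilterDesign S) (y : ℕ → Y) (x : X) : ℝ≥0∞ :=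
  (A.r x : ℝ≥0∞) * S.g x (y 0)

/-- The importance weight function at time `t ≥ 1`. It takes values in `[0, ∞]`: a vanishing
denominator under a positive numerator gives `∞`. -/
def FilterDesign.weightFn (A : FilterDesign S) (y : ℕ → Y) (t : ℕ) (x x' : X) : ℝ≥0∞ :=
  ((S.m x x' : ℝ≥0∞) * S.g x' (y t)) / ((A.ϑ t x : ℝ≥0∞) * A.p t x x')

/-- Adjustment multipliers and importance weight functions are bounded uniformly in time. -/
def FilterDesign.BoundedWeights (A : FilterDesign S) (y : ℕ → Y) : Prop :=
  (⨆ t, ⨆ (_ : 1 ≤ t), ⨆ x, (A.ϑ t x : ℝ≥0∞)) < ⊤ ∧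
  (⨆ x, A.weightFn₀ y x) < ⊤ ∧
  (⨆ t, ⨆ (_ : 1 ≤ t), ⨆ x, ⨆ x', A.weightFn y t x x') < ⊤

section Particles

variable {Ω : Type w} {N : ℕ}

/-- The importance weights `ω_t^i` of the particles `ξ_t^i` with ancestor indices `I_t^i`. -/
def FilterDesign.weight (A : FilterDesign S) (y : ℕ → Y) (ξ : ℕ → Fin N → Ω → X)
    (I : ℕ → Fin N → Ω → Fin N) : ℕ → Fin N → Ω → ℝ≥0
  | 0, i, ω => (A.weightFn₀ y (ξ 0 i ω)).toNNReal
  | t + 1, i, ω => (A.weightFn y (t + 1) (ξ t (I (t + 1) i ω) ω) (ξ (t + 1) i ω)).toNNReal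

/-- The `σ`-algebra generated by the particles and the weights up to time `t`. -/
@[reducible]
def FilterDesign.history (A : FilterDesign S) (y : ℕ → Y) (ξ : ℕ → Fin N → Ω → X)
    (I : ℕ → Fin N → Ω → Fin N) (t : ℕ) : MeasurableSpace Ω :=
  ⨆ s, ⨆ (_ : s ≤ t), ⨆ i : Fin N,
    MeasurableSpace.comap (fun ω => (ξ s i ω, A.weight y ξ I s i ω)) inferInstance

/-- The instrumental distribution at time `t + 1` of a pair (index, particle) given the weighted
sample at time `t`: the probability measure on `{1, …, N} × X` with
`(i, D) ↦ ω_t^i ϑ_{t+1}(ξ_t^i) P_{t+1}(ξ_t^i, D)` up to normalization. -/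
def FilterDesign.instrumental (A : FilterDesign S) (y : ℕ → Y) (ξ : ℕ → Fin N → Ω → X)
    (I : ℕ → Fin N → Ω → Fin N) (t : ℕ) (ω : Ω) : Measure (Fin N × X) :=
  (∑ i, ((A.weight y ξ I t i ω * A.ϑ (t + 1) (ξ t i ω) : ℝ≥0) : ℝ≥0∞))⁻¹ •
    ∑ i, ((A.weight y ξ I t i ω * A.ϑ (t + 1) (ξ t i ω) : ℝ≥0) : ℝ≥0∞) •
      (Measure.dirac i).prod (A.P (t + 1) (ξ t i ω))

/-- `(ξ, I)` is an auxiliary particle filter with `N` particles: the initial particles are i.i.d.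
from `ρ₀`, and given the particles and weights up to time `t`, the pairs
`(I_{t+1}^i, ξ_{t+1}^i)`, `i = 1, …, N`, are i.i.d. from the instrumental distribution.
The field `total_pos` says that the weights never vanish simultaneously, so that the
normalizations in the algorithm make sense. -/
structure FilterDesign.IsParticleFilter (A : FilterDesign S) (y : ℕ → Y) [MeasurableSpace Ω]
    (μ : Measure Ω) (ξ : ℕ → Fin N → Ω → X) (I : ℕ → Fin N → Ω → Fin N) : Prop where
  measurable_ξ : ∀ t i, Measurable (ξ t i)
  measurable_I : ∀ t i, Measurable (I t i)
  init : μ.map (fun ω i => ξ 0 i ω) = Measure.pi (fun _ : Fin N => A.ρ₀)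
  step : ∀ t, HasCondLaw μ (A.history y ξ I t)
    (fun ω (i : Fin N) => (I (t + 1) i ω, ξ (t + 1) i ω))
    (fun ω => Measure.pi (fun _ : Fin N => A.instrumental y ξ I t ω))
  total_pos : ∀ t, ∀ᵐ ω ∂μ, 0 < ∑ i, A.weight y ξ I t i ω

/-- The particle approximation `∑_i (ω_t^i / Ω_t) δ_{ξ_t^i}` of the filtering distribution. -/
def FilterDesign.filterHat (A : FilterDesign S) (y : ℕ → Y) (ξ : ℕ → Fin N → Ω → X)
    (I : ℕ → Fin N → Ω → Fin N) (ω : Ω) (t : ℕ) : Measure X :=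
  ∑ i, ((A.weight y ξ I t i ω / ∑ j, A.weight y ξ I t j ω : ℝ≥0) : ℝ≥0∞) •
    Measure.dirac (ξ t i ω)

/-- The marginal forward filtering backward smoothing estimator `φ̂_{s|T}(h)`: the filter
approximation at time `T`, followed by the backward kernels of the filter approximations at the
times `T - 1, …, s`. -/
def FilterDesign.ffbs (A : FilterDesign S) (y : ℕ → Y) (ξ : ℕ → Fin N → Ω → X)
    (I : ℕ → Fin N → Ω → Fin N) (T : ℕ) (s : Fin (T + 1)) (h : X → ℝ) (ω : Ω) : ℝ :=
  ∫ x, S.backwardIter (A.filterHat y ξ I ω) s h (T - s) x ∂(A.filterHat y ξ I ω T)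

/-- The backward transition matrix
`Λ_t(i, j) = ω_t^j m(ξ_t^j, ξ_{t+1}^i) / ∑_l ω_t^l m(ξ_t^l, ξ_{t+1}^i)`. -/
def FilterDesign.backwardMatrix (A : FilterDesign S) (y : ℕ → Y) (ξ : ℕ → Fin N → Ω → X)
    (I : ℕ → Fin N → Ω → Fin N) (t : ℕ) (ω : Ω) (i j : Fin N) : ℝ≥0 :=
  A.weight y ξ I t j ω * S.m (ξ t j ω) (ξ (t + 1) i ω) /
    ∑ l, A.weight y ξ I t l ω * S.m (ξ t l ω) (ξ (t + 1) i ω)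

/-- The law of a backward index path `J_{0:T}`, with mass
`(ω_T^{j_T} / Ω_T) ∏_{t < T} Λ_t(j_{t+1}, j_t)` at `j_{0:T}`. -/
def FilterDesign.indexPathLaw (A : FilterDesign S) (y : ℕ → Y) (ξ : ℕ → Fin N → Ω → X)
    (I : ℕ → Fin N → Ω → Fin N) (T : ℕ) (ω : Ω) : Measure (Fin (T + 1) → Fin N) :=
  ∑ j : Fin (T + 1) → Fin N,
    ((A.weight y ξ I T (j (Fin.last T)) ω / (∑ i, A.weight y ξ I T i ω) *
      ∏ t : Fin T, A.backwardMatrix y ξ I t ω (j t.succ) (j t.castSucc) : ℝ≥0) : ℝ≥0∞) •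
      Measure.dirac j

/-- `J^1, …, J^N` are backward index paths as simulated by the FFBSi algorithm: conditionally on
the particles and weights up to time `T`, they are i.i.d. from `indexPathLaw`. -/
structure FilterDesign.IsBackwardSimulation (A : FilterDesign S) (y : ℕ → Y)
    [MeasurableSpace Ω] (μ : Measure Ω) (ξ : ℕ → Fin N → Ω → X) (I : ℕ → Fin N → Ω → Fin N)
    (T : ℕ) (J : Fin N → Fin (T + 1) → Ω → Fin N) : Prop where
  measurable_J : ∀ l t, Measurable (J l t)
  condLaw : HasCondLaw μ (A.history y ξ I T) (fun ω l t => J l t ω)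
    (fun ω => Measure.pi (fun _ : Fin N => A.indexPathLaw y ξ I T ω))

/-- The joint forward filtering backward simulation estimator
`φ̃_{0:T|T}(H) = N⁻¹ ∑_l H(ξ_0^{J_0^l}, …, ξ_T^{J_T^l})`. -/
def jointFFBSi (ξ : ℕ → Fin N → Ω → X) (T : ℕ) (J : Fin N → Fin (T + 1) → Ω → Fin N)
    (H : (Fin (T + 1) → X) → ℝ) (ω : Ω) : ℝ :=
  (N : ℝ)⁻¹ * ∑ l, H (fun t => ξ t (J l t ω) ω)

/-- The marginal forward filtering backward simulation estimator `φ̃_{s|T}(h)`. -/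
def ffbsi (ξ : ℕ → Fin N → Ω → X) (T : ℕ) (J : Fin N → Fin (T + 1) → Ω → Fin N)
    (s : Fin (T + 1)) (h : X → ℝ) (ω : Ω) : ℝ :=
  jointFFBSi ξ T J (fun x => h (x s)) ω

end Particles

end Model

end

end ParticleSmoothing

open ParticleSmoothing

/-! Write `β_t(x)` for the likelihood of the observations at times `t + 1, …, T` given `X_t = x`
(`lookahead`), and `Ψ_t(x)` for the expectation of `h(X_s)` given `X_t = x` (`condSmoother`). For `t
< s`, `Ψ_t` is exact; for `t ≥ s` it is computed with the backward kernels of the particle samples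
at times `s, …, t - 1`. The hybrid estimate `sampleSmoother` at time `t` is the mean of `Ψ_t` over
the sample at time `t` with weights `ω_t^i β_t(ξ_t^i)`. At `t = T` it is the FFBS estimator, so the
FFBS error telescopes into the initial error and the increments between consecutive hybrid
estimates.

Given the particles and weights up to time `t`, the estimate at time `t + 1` is a ratio of sums over
i.i.d. draws, and the ratio of the conditional means is exactly the estimate at time `t`
(`sum_integral_condSmoother`, `integral_instrumental`). Hoeffding for self-normalized ratios
(`measure_pi_ratio_le`) then bounds the increment. Two effects of mixing make the bounds uniform in
`T`. By the Harnack inequality `lookahead_harnack`, `β_t` varies at most by the factor `b / a`, so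
after division by its value at one point the weights have bounds independent of `t` and `T`. By
Doeblin contraction (`exists_Icc_weighted_mean`), `Ψ_t` ranges over an interval of length at most `κ
^ |t - s| * osc h`, on both sides of `s`.

With `κ = θ ^ 2`, increment `t` is allotted a share of `ε` proportional to `θ ^ |t - s|`. The shares
have a bounded sum but decay more slowly than the ranges, so the union bound sums to one Gaussian
tail (`exists_sum_hoeffdingBound_le`).

Given the samples, FFBSi is an i.i.d. average whose conditional mean is the FFBS estimator
(`integral_indexPathLaw_apply`); one more conditional Hoeffding bound finishes the proof. -/

namespace ParticleSmoothing

/-! ### Hoeffding inequalities for i.i.d. samples and their conditional use -/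

noncomputable section

/-- One-sided Hoeffding inequality for an i.i.d. sample of a bounded function. -/
theorem measureReal_pi_sum_ge_le {E : Type*} [MeasurableSpace E] (q : Measure E)
    [IsProbabilityMeasure q] (N : ℕ) {Y : E → ℝ} (hY : Measurable Y) {a b : ℝ}
    (hab : ∀ z, Y z ∈ Set.Icc a b) {η : ℝ} (hη : 0 ≤ η) :
    (Measure.pi (fun _ : Fin N => q)).real {z | N * η ≤ ∑ i, (Y (z i) - ∫ e, Y e ∂q)}
      ≤ Real.exp (-(2 * N * η ^ 2 / (b - a) ^ 2)) := by
  have hmean : ∀ i : Fin N, ∫ z, Y (z i) ∂(Measure.pi (fun _ : Fin N => q)) = ∫ e, Y e ∂q :=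
    fun i => integral_comp_eval (μ := fun _ : Fin N => q) hY.aestronglyMeasurable
  have hsub : ∀ i ∈ (Finset.univ : Finset (Fin N)),
      HasSubgaussianMGF (fun z : Fin N → E => Y (z i) - ∫ e, Y e ∂q)
        ((‖b - a‖₊ / 2) ^ 2) (Measure.pi (fun _ : Fin N => q)) := by
    intro i _
    have := hasSubgaussianMGF_of_mem_Icc (μ := Measure.pi (fun _ : Fin N => q))
      (X := fun z : Fin N → E => Y (z i)) (a := a) (b := b)
      (hY.comp (measurable_pi_apply i)).aemeasurable
      (Filter.Eventually.of_forall fun z => hab (z i))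
    rwa [hmean i] at this
  have hind : iIndepFun (fun (i : Fin N) (z : Fin N → E) => Y (z i) - ∫ e, Y e ∂q)
      (Measure.pi (fun _ : Fin N => q)) :=
    iIndepFun_pi (μ := fun _ : Fin N => q) (X := fun _ e => Y e - ∫ e, Y e ∂q)
      (fun i => (hY.sub_const _).aemeasurable)
  have h0 : (0 : ℝ) ≤ N * η := by positivity
  refine (HasSubgaussianMGF.measure_sum_ge_le_of_iIndepFun hind hsub h0).trans
    (Real.exp_le_exp.2 (le_of_eq ?_))
  simp only [Finset.sum_const, Finset.card_univ, Fintype.card_fin, nsmul_eq_mul, NNReal.coe_mul,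
    NNReal.coe_natCast, NNReal.coe_pow, NNReal.coe_div, coe_nnnorm, Real.norm_eq_abs,
    NNReal.coe_ofNat, div_pow, sq_abs]
  rcases eq_or_ne (N : ℝ) 0 with hN | hN
  -- In both degenerate cases, `N = 0` and `b = a`, division by zero gives exponent `0` on each
  -- side.
  · simp [hN]
  rcases eq_or_ne (b - a) 0 with hc | hc
  · simp [hc]
  field_simp

/-- Two-sided Hoeffding inequality for the empirical mean of an i.i.d. sample. -/
theorem measure_pi_abs_mean_sub_le {E : Type*} [MeasurableSpace E] (q : Measure E)
    [IsProbabilityMeasure q] {N : ℕ} (hN : 1 ≤ N) {Y : E → ℝ} (hY : Measurable Y) {a o : ℝ}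
    (hab : ∀ z, Y z ∈ Set.Icc a (a + o)) {δ : ℝ} (hδ : 0 < δ) :
    Measure.pi (fun _ : Fin N => q) {z | δ ≤ |(N : ℝ)⁻¹ * ∑ i, Y (z i) - ∫ e, Y e ∂q|}
      ≤ ENNReal.ofReal (hoeffdingBound 2 2 N δ o) := by
  have hN' : (0 : ℝ) < N := by exact_mod_cast hN
  unfold hoeffdingBound
  split_ifs with ho
  · have hc : ∀ z, Y z = a := fun z => by
      have := hab z; rw [ho, add_zero, Set.Icc_self] at this; exact this
    have : {z : Fin N → E | δ ≤ |(N : ℝ)⁻¹ * ∑ i, Y (z i) - ∫ e, Y e ∂q|} = ∅ := by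
      ext z
      simp [hc, hN'.ne', hδ]
    rw [this]; simp
  have key : ∀ z : Fin N → E, δ ≤ |(N : ℝ)⁻¹ * ∑ i, Y (z i) - ∫ e, Y e ∂q| →
      (N * δ ≤ ∑ i, (Y (z i) - ∫ e, Y e ∂q)) ∨
      (N * δ ≤ ∑ i, ((fun e => - Y e) (z i) - ∫ e, (fun e => - Y e) e ∂q)) := by
    intro z hz
    simp only [integral_neg, Finset.sum_sub_distrib, Finset.sum_neg_distrib, Finset.sum_const,
      Finset.card_univ, Fintype.card_fin, nsmul_eq_mul]
    have e1 : (N : ℝ) * ((N : ℝ)⁻¹ * ∑ i, Y (z i) - ∫ e, Y e ∂q)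
        = ∑ i, Y (z i) - N * ∫ e, Y e ∂q := by field_simp
    rcases le_abs.1 hz with h | h
    · left; rw [← e1]; gcongr
    · right
      have := mul_le_mul_of_nonneg_left h hN'.le
      linarith
  have h1 := measureReal_pi_sum_ge_le q N hY hab hδ.le
  have h2 := measureReal_pi_sum_ge_le q N hY.neg (a := -(a + o)) (b := -a)
    (fun z => ⟨neg_le_neg (hab z).2, neg_le_neg (hab z).1⟩) hδ.le
  rw [show a + o - a = o by ring] at h1
  rw [show -a - -(a + o) = o by ring] at h2
  rw [← ofReal_measureReal]
  refine ENNReal.ofReal_le_ofReal ?_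
  calc _ ≤ (Measure.pi (fun _ : Fin N => q)).real
        ({z | N * δ ≤ ∑ i, (Y (z i) - ∫ e, Y e ∂q)} ∪
          {z | N * δ ≤ ∑ i, ((fun e => - Y e) (z i) - ∫ e, (fun e => - Y e) e ∂q)}) :=
        measureReal_mono fun z hz => key z hz
    _ ≤ _ := measureReal_union_le _ _
    _ ≤ _ := add_le_add h1 h2
    _ = _ := by ring

/-- Hoeffding inequality for a self-normalized importance sampling estimator
`∑ u(zᵢ) ψ(zᵢ) / ∑ u(zᵢ)` of a weighted mean `R`. -/
theorem measure_pi_ratio_le {E : Type*} [MeasurableSpace E] (q : Measure E)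
    [IsProbabilityMeasure q] (N : ℕ) {u ψ : E → ℝ} (hu : Measurable u) (hψ : Measurable ψ)
    {K d lo o R δ : ℝ} (hd : 0 < d) (huK : ∀ z, u z ∈ Set.Icc 0 K)
    (hud : d ≤ ∫ z, u z ∂q) (hψo : ∀ z, ψ z ∈ Set.Icc lo (lo + o))
    (hR : ∫ z, u z * ψ z ∂q = R * ∫ z, u z ∂q) (hδ : 0 < δ) :
    Measure.pi (fun _ : Fin N => q)
      {z | 0 < ∑ i, u (z i) ∧ δ ≤ |(∑ i, u (z i) * ψ (z i)) / (∑ i, u (z i)) - R|}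
      ≤ ENNReal.ofReal (hoeffdingBound 2 (d ^ 2 / (8 * K ^ 2)) N δ o) := by
  have hui : Integrable u q := Integrable.of_mem_Icc 0 K hu.aemeasurable
    (Filter.Eventually.of_forall huK)
  have huψ : Integrable (fun z => u z * ψ z) q := by
    refine hui.mul_bdd (c := |lo| + |lo + o|) hψ.aestronglyMeasurable
      (Filter.Eventually.of_forall fun z => ?_)
    exact (abs_le_max_abs_abs (hψo z).1 (hψo z).2).trans
      (max_le (le_add_of_nonneg_right (abs_nonneg _)) (le_add_of_nonneg_left (abs_nonneg _)))
  have hU : 0 < ∫ z, u z ∂q := hd.trans_le hud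
  have hRlo : lo ≤ R := by
    have : ∫ z, u z * lo ∂q ≤ ∫ z, u z * ψ z ∂q :=
      integral_mono (hui.mul_const _) huψ
        fun z => mul_le_mul_of_nonneg_left (hψo z).1 (huK z).1
    rw [integral_mul_const, hR, mul_comm] at this
    exact le_of_mul_le_mul_right this hU
  have hRhi : R ≤ lo + o := by
    have : ∫ z, u z * ψ z ∂q ≤ ∫ z, u z * (lo + o) ∂q :=
      integral_mono huψ (hui.mul_const _)
        fun z => mul_le_mul_of_nonneg_left (hψo z).2 (huK z).1
    rw [integral_mul_const, hR, mul_comm (∫ z, u z ∂q)] at this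
    exact le_of_mul_le_mul_right this hU
  have hψR : ∀ z, |ψ z - R| ≤ o := fun z => by
    have h1 := (hψo z).1
    have h2 := (hψo z).2
    rw [abs_le]; constructor <;> linarith
  have hdiff : ∀ z : Fin N → E, 0 < ∑ i, u (z i) →
      (∑ i, u (z i) * ψ (z i)) / (∑ i, u (z i)) - R
        = (∑ i, u (z i) * (ψ (z i) - R)) / ∑ i, u (z i) := by
    intro z hz
    rw [div_sub' hz.ne']
    congr 1
    simp only [mul_sub, Finset.sum_sub_distrib, Finset.sum_mul]
  -- The error is a weighted mean of `ψ - R`, so it never exceeds `o`. For `o < δ` the event is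
  -- empty; otherwise `δ ≤ o` will bound the variables below.
  by_cases hδo : o < δ
  · have : {z : Fin N → E | 0 < ∑ i, u (z i) ∧
        δ ≤ |(∑ i, u (z i) * ψ (z i)) / (∑ i, u (z i)) - R|} = ∅ := by
      ext z
      simp only [Set.mem_ofPred_eq, Set.mem_empty_iff_false, iff_false, not_and, not_le]
      intro hz
      rw [hdiff z hz, abs_div, abs_of_pos hz, div_lt_iff₀ hz]
      calc |∑ i, u (z i) * (ψ (z i) - R)| ≤ ∑ i, |u (z i) * (ψ (z i) - R)| :=
            Finset.abs_sum_le_sum_abs _ _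
        _ ≤ ∑ i, u (z i) * o := by
            gcongr with i
            rw [abs_mul, abs_of_nonneg (huK _).1]
            exact mul_le_mul_of_nonneg_left (hψR _) (huK _).1
        _ = o * ∑ i, u (z i) := by rw [← Finset.sum_mul, mul_comm]
        _ < δ * ∑ i, u (z i) := by gcongr
    rw [this]; simp
  push Not at hδo
  have ho : 0 < o := hδ.trans_le hδo
  unfold hoeffdingBound
  rw [if_neg ho.ne']
  have hKpos : 0 < K := by
    have : ∫ z, u z ∂q ≤ K := by
      simpa using integral_mono hui (integrable_const K) (fun z => (huK z).2)
    linarith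
  -- Linearization of the ratio: on the event, the sum of `Yc c` is nonnegative for `c = 1` or `c =
  -- -1`, while its mean is `-δ ∫ u ≤ -δ d` because `u (ψ - R)` is centred. Since `|Yc c| ≤ 2 K o`,
  -- this is a one-sided deviation by `δ d`, with exponent `2 N (δ d)² / (4 K o)²`.
  let Yc : ℝ → E → ℝ := fun c e => c * (u e * (ψ e - R)) - δ * u e
  have hYc : ∀ c, Measurable (Yc c) := fun c =>
    ((hu.mul (hψ.sub_const R)).const_mul c).sub (hu.const_mul δ)
  have hYb : ∀ c : ℝ, |c| = 1 → ∀ e, Yc c e ∈ Set.Icc (-(2 * K * o)) (2 * K * o) := by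
    intro c hc e
    rw [Set.mem_Icc, ← abs_le]
    have h1 : |u e| ≤ K := by rw [abs_of_nonneg (huK e).1]; exact (huK e).2
    calc |c * (u e * (ψ e - R)) - δ * u e| ≤ |c * (u e * (ψ e - R))| + |δ * u e| := abs_sub _ _
      _ = |u e| * |ψ e - R| + δ * |u e| := by
        rw [abs_mul, abs_mul, abs_mul, hc, one_mul, abs_of_pos hδ]
      _ ≤ K * o + o * K := by
        gcongr
        exact hψR e
      _ = 2 * K * o := by ring
  have one_side : ∀ c : ℝ, |c| = 1 → (Measure.pi (fun _ : Fin N => q)).real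
      {z | N * (δ * d) ≤ ∑ i, (Yc c (z i) - ∫ e, Yc c e ∂q)}
      ≤ Real.exp (-(2 * N * (δ * d) ^ 2 / (2 * K * o - -(2 * K * o)) ^ 2)) :=
    fun c hc => measureReal_pi_sum_ge_le q N (hYc c) (hYb c hc) (by positivity)
  have hmean : ∀ c : ℝ, ∫ e, Yc c e ∂q = -(δ * ∫ z, u z ∂q) := by
    intro c
    have : ∀ e, Yc c e = c * (u e * ψ e) - (c * R + δ) * u e :=
      fun e => by simp only [Yc]; ring
    simp_rw [this]
    rw [integral_sub (huψ.const_mul c) (hui.const_mul _), integral_const_mul,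
      integral_const_mul, hR]
    ring
  have key : ∀ z : Fin N → E, (0 < ∑ i, u (z i) ∧
      δ ≤ |(∑ i, u (z i) * ψ (z i)) / (∑ i, u (z i)) - R|) →
      (N * (δ * d) ≤ ∑ i, (Yc 1 (z i) - ∫ e, Yc 1 e ∂q)) ∨
      (N * (δ * d) ≤ ∑ i, (Yc (-1) (z i) - ∫ e, Yc (-1) e ∂q)) := by
    rintro z ⟨hz, hz2⟩
    rw [hdiff z hz, abs_div, abs_of_pos hz, le_div_iff₀ hz] at hz2
    have h3 : (N : ℝ) * (δ * d) ≤ N * (δ * ∫ z, u z ∂q) := by gcongr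
    simp only [hmean, Yc, Finset.sum_sub_distrib, ← Finset.mul_sum, Finset.sum_const,
      Finset.card_univ, Fintype.card_fin, nsmul_eq_mul]
    rcases le_abs.1 hz2 with h | h
    · left; linarith
    · right; linarith
  rw [← ofReal_measureReal]
  refine ENNReal.ofReal_le_ofReal ?_
  calc _ ≤ (Measure.pi (fun _ : Fin N => q)).real
        ({z | N * (δ * d) ≤ ∑ i, (Yc 1 (z i) - ∫ e, Yc 1 e ∂q)} ∪
          {z | N * (δ * d) ≤ ∑ i, (Yc (-1) (z i) - ∫ e, Yc (-1) e ∂q)}) :=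
        measureReal_mono fun z hz => key z hz
    _ ≤ _ := measureReal_union_le _ _
    _ ≤ _ := add_le_add (one_side 1 (by simp)) (one_side (-1) (by simp))
    _ = _ := by
      rw [← two_mul]
      congr 3
      field_simp
      ring

/-- A conditional bound on the probability of an event that depends on the conditioning data `D`
and on `Z` gives an unconditional bound. -/
theorem HasCondLaw.measure_le {Ω E H : Type*} {F : MeasurableSpace Ω} [mΩ : MeasurableSpace Ω]
    [MeasurableSpace E] [MeasurableSpace H] {μ : Measure Ω} [IsProbabilityMeasure μ]
    {Z : Ω → E} {κ : Ω → Measure E} (hκ : HasCondLaw μ F Z κ) (hZ : Measurable Z) {D : Ω → H}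
    (hD : Measurable[F] D) {A : Set (H × E)} (hA : MeasurableSet A) {c : ℝ≥0∞}
    (hc : ∀ᵐ ω ∂μ, κ ω {z | (D ω, z) ∈ A} ≤ c) :
    μ {ω | (D ω, Z ω) ∈ A} ≤ c := by
  classical
  have hD' : Measurable D := hD.mono hκ.le le_rfl
  have hm : Measurable (fun ω => κ ω Set.univ) :=
    (hκ.measurable_law Set.univ MeasurableSet.univ).mono hκ.le le_rfl
  -- `HasCondLaw` does not require `κ ω` to be a probability. Testing `law_eq` on the event where
  -- the mass exceeds `1` shows that this event is null.
  have hmass : ∀ᵐ ω ∂μ, κ ω Set.univ ≤ 1 := by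
    by_contra hcon
    have hG : MeasurableSet[F] {ω | 1 < κ ω Set.univ} :=
      (hκ.measurable_law Set.univ MeasurableSet.univ) measurableSet_Ioi
    have hG0 : μ {ω | 1 < κ ω Set.univ} ≠ 0 := by
      rw [ae_iff] at hcon
      simpa only [not_le] using hcon
    have h1 := hκ.law_eq _ hG Set.univ MeasurableSet.univ
    rw [Set.preimage_univ, Set.inter_univ] at h1
    have h2 := setLIntegral_strict_mono (μ := μ) (f := fun _ => (1 : ℝ≥0∞)) (hκ.le _ hG) hG0 hm
      (by simp) (Filter.Eventually.of_forall fun ω hω => hω)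
    rw [← h1, setLIntegral_one] at h2
    exact lt_irrefl _ h2
  have hset : MeasurableSet {ω | κ ω Set.univ ≤ 1} := hm measurableSet_Iic
  -- Setting `κ` to zero on the null event gives a finite kernel, so that `μ ⊗ₘ κ'` is available and
  -- the joint law of `(D, Z)` can be identified on rectangles.
  let κ' : Kernel Ω E :=
    { toFun := fun ω => if κ ω Set.univ ≤ 1 then κ ω else 0
      measurable' := by
        refine Measurable.ite hset ?_ measurable_const
        exact Measure.measurable_of_measurable_coe _ fun B hB =>
          (hκ.measurable_law B hB).mono hκ.le le_rfl }
  have hκ' : ∀ ω, κ' ω = if κ ω Set.univ ≤ 1 then κ ω else 0 := fun ω => rfl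
  have : IsFiniteKernel κ' := ⟨1, ENNReal.one_lt_top, fun ω => by
    rw [hκ']; split_ifs with h
    · exact h
    · simp⟩
  have hae : ∀ᵐ ω ∂μ, κ' ω = κ ω := by
    filter_upwards [hmass] with ω hω
    rw [hκ', if_pos hω]
  have hDm : Measurable (fun p : Ω × E => (D p.1, p.2)) := by fun_prop
  have heq : μ.map (fun ω => (D ω, Z ω)) = (μ ⊗ₘ κ').map (fun p => (D p.1, p.2)) := by
    refine Measure.ext_prod fun {C B} hC hB => ?_
    rw [Measure.map_apply (hD'.prodMk hZ) (hC.prod hB), Measure.map_apply hDm (hC.prod hB)]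
    have e1 : (fun p : Ω × E => (D p.1, p.2)) ⁻¹' C ×ˢ B = (D ⁻¹' C) ×ˢ B := by
      ext p; simp
    have e2 : (fun ω => (D ω, Z ω)) ⁻¹' C ×ˢ B = D ⁻¹' C ∩ Z ⁻¹' B := by
      ext p; simp
    rw [e1, e2, Measure.compProd_apply_prod (hD' hC) hB, hκ.law_eq _ (hD hC) B hB]
    exact lintegral_congr_ae (ae_restrict_of_ae (by filter_upwards [hae] with ω hω; rw [hω]))
  have h1 : μ {ω | (D ω, Z ω) ∈ A} = ∫⁻ ω, κ' ω {z | (D ω, z) ∈ A} ∂μ := by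
    change μ ((fun ω => (D ω, Z ω)) ⁻¹' A) = _
    rw [← Measure.map_apply (hD'.prodMk hZ) hA, heq, Measure.map_apply hDm hA,
      Measure.compProd_apply (hDm hA)]
    rfl
  rw [h1]
  calc ∫⁻ ω, κ' ω {z | (D ω, z) ∈ A} ∂μ ≤ ∫⁻ _, c ∂μ := by
        refine lintegral_mono_ae ?_
        filter_upwards [hae, hc] with ω h2 h3
        rwa [h2]
    _ = c := by simp

end

/-! ### Doeblin contraction -/

noncomputable section

/-- Doeblin contraction: averaging with respect to the normalization of `k x · v`, where
`a ≤ k ≤ b`, contracts the range of a function by the factor `1 - a / b`. -/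
theorem exists_Icc_weighted_mean {ι E : Type*} [MeasurableSpace E] (lam : Measure E)
    {k : ι → E → ℝ} {v f : E → ℝ} {a b lo o : ℝ} (hk : ∀ x, Measurable (k x)) (ha : 0 < a)
    (hkab : ∀ x e, k x e ∈ Set.Icc a b) (hv : Integrable v lam) (hv0 : ∀ e, 0 ≤ v e)
    (hvpos : 0 < ∫ e, v e ∂lam) (hf : Measurable f) (hfo : ∀ e, f e ∈ Set.Icc lo (lo + o)) :
    ∃ lo', ∀ x, (∫ e, k x e * v e * f e ∂lam) / (∫ e, k x e * v e ∂lam)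
      ∈ Set.Icc lo' (lo' + (1 - a / b) * o) := by
  have hbdd : ∀ e, ‖f e‖ ≤ |lo| + |lo + o| := fun e =>
    (abs_le_max_abs_abs (hfo e).1 (hfo e).2).trans
      (max_le (le_add_of_nonneg_right (abs_nonneg _)) (le_add_of_nonneg_left (abs_nonneg _)))
  have hvf : Integrable (fun e => v e * f e) lam :=
    hv.mul_bdd hf.aestronglyMeasurable (Filter.Eventually.of_forall hbdd)
  have hkv : ∀ x, Integrable (fun e => k x e * v e) lam := fun x =>
    hv.bdd_mul (c := b) (hk x).aestronglyMeasurable (Filter.Eventually.of_forall fun e => by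
      rw [Real.norm_eq_abs, abs_of_pos (ha.trans_le (hkab x e).1)]; exact (hkab x e).2)
  have hkvf : ∀ x, Integrable (fun e => k x e * v e * f e) lam := fun x =>
    (hkv x).mul_bdd hf.aestronglyMeasurable (Filter.Eventually.of_forall hbdd)
  set V := ∫ e, v e ∂lam with hV
  set F := ∫ e, v e * f e ∂lam with hF
  -- The normalized weight dominates `a / b` times `v / V`, since `k ≥ a` and `D ≤ b V`. The common
  -- part contributes `a / b * (F / V)` for every `x`; the remaining mass `1 - a / b` contributes at
  -- least `(1 - a / b) * lo`.
  refine ⟨lo + a / b * (F / V - lo), fun x => ?_⟩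
  set D := ∫ e, k x e * v e ∂lam with hD
  set Q := ∫ e, k x e * v e * f e ∂lam with hQ
  have hDlo : a * V ≤ D := by
    rw [hV, hD, ← integral_const_mul]
    exact integral_mono (hv.const_mul _) (hkv x)
      fun e => mul_le_mul_of_nonneg_right (hkab x e).1 (hv0 e)
  have hDhi : D ≤ b * V := by
    rw [hV, hD, ← integral_const_mul]
    exact integral_mono (hkv x) (hv.const_mul _)
      fun e => mul_le_mul_of_nonneg_right (hkab x e).2 (hv0 e)
  have hDpos : 0 < D := (mul_pos ha hvpos).trans_le hDlo
  have h1 : a * (F - lo * V) ≤ Q - lo * D := by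
    rw [hF, hV, hQ, hD, ← integral_const_mul, ← integral_sub hvf (hv.const_mul _),
      ← integral_const_mul, ← integral_const_mul lo, ← integral_sub (hkvf x) ((hkv x).const_mul _)]
    refine integral_mono ((hvf.sub (hv.const_mul _)).const_mul _)
      ((hkvf x).sub ((hkv x).const_mul _)) fun e => ?_
    have h3 := mul_le_mul_of_nonneg_right (hkab x e).1
      (mul_nonneg (hv0 e) (sub_nonneg.2 (hfo e).1))
    simp only
    linarith
  have h2 : a * ((lo + o) * V - F) ≤ (lo + o) * D - Q := by
    rw [hF, hV, hQ, hD, ← integral_const_mul, ← integral_sub (hv.const_mul _) hvf,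
      ← integral_const_mul, ← integral_const_mul (lo + o),
      ← integral_sub ((hkv x).const_mul _) (hkvf x)]
    refine integral_mono (((hv.const_mul _).sub hvf).const_mul _)
      (((hkv x).const_mul _).sub (hkvf x)) fun e => ?_
    have h3 := mul_le_mul_of_nonneg_right (hkab x e).1
      (mul_nonneg (hv0 e) (sub_nonneg.2 (hfo e).2))
    simp only
    linarith
  have hF1 : lo * V ≤ F := by
    rw [hF, hV, ← integral_const_mul]
    refine integral_mono (hv.const_mul _) hvf fun e => ?_
    simp only
    rw [mul_comm]
    exact mul_le_mul_of_nonneg_left (hfo e).1 (hv0 e)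
  have hF2 : F ≤ (lo + o) * V := by
    rw [hF, hV, ← integral_const_mul]
    refine integral_mono hvf (hv.const_mul _) fun e => ?_
    simp only
    rw [mul_comm]
    exact mul_le_mul_of_nonneg_right (hfo e).2 (hv0 e)
  have scale : ∀ A : ℝ, 0 ≤ A → a / b * (A / V) ≤ a * A / D := by
    intro A hA
    rw [div_mul_div_comm]
    exact div_le_div_of_nonneg_left (by positivity) hDpos hDhi
  constructor
  · have h4 := (scale _ (sub_nonneg.2 hF1)).trans (div_le_div_of_nonneg_right h1 hDpos.le)
    rw [sub_div, sub_div, mul_div_cancel_right₀ _ hvpos.ne', mul_div_cancel_right₀ _ hDpos.ne']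
      at h4
    linarith
  · have h4 := (scale _ (sub_nonneg.2 hF2)).trans (div_le_div_of_nonneg_right h2 hDpos.le)
    rw [sub_div, sub_div, mul_div_cancel_right₀ _ hvpos.ne', mul_div_cancel_right₀ _ hDpos.ne']
      at h4
    linarith

/-! ### Look-ahead functions and the exact smoothing law -/

variable {X Y : Type*} [MeasurableSpace X] [MeasurableSpace Y]

/-- The likelihood function `g_t`. -/
def StateSpaceModel.lik (S : StateSpaceModel X Y) (y : ℕ → Y) (t : ℕ) (x : X) : ℝ :=
  S.g x (y t)

/-- The function
`x ↦ ∫ ⋯ ∫ M(x, dx_{t+1}) f_{t+1}(x_{t+1}) ⋯ M(x_{t+k-1}, dx_{t+k}) f_{t+k}(x_{t+k})`. -/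
def StateSpaceModel.lookahead (S : StateSpaceModel X Y) (f : ℕ → X → ℝ) : ℕ → ℕ → X → ℝ
  | _, 0, _ => 1
  | t, k + 1, x => ∫ x', f (t + 1) x' * S.lookahead f (t + 1) k x' ∂(S.M x)

/-- The likelihoods, with an extra factor `h` at time `s`. -/
def StateSpaceModel.likAt (S : StateSpaceModel X Y) (y : ℕ → Y) (s : ℕ) (h : X → ℝ) (t : ℕ)
    (x : X) : ℝ :=
  if t = s then S.lik y t x * h x else S.lik y t x

/-- Measurable and bounded real functions. -/
def BddMeas {E : Type*} [MeasurableSpace E] (f : E → ℝ) : Prop :=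
  Measurable f ∧ ∃ K, ∀ x, |f x| ≤ K

section BddMeas

variable {E : Type*} [MeasurableSpace E] {f g : E → ℝ}

theorem BddMeas.integrable (hf : BddMeas f) (μ : Measure E) [IsFiniteMeasure μ] :
    Integrable f μ := by
  obtain ⟨hf1, K, hK⟩ := hf
  exact Integrable.of_bound hf1.aestronglyMeasurable K (Filter.Eventually.of_forall hK)

theorem BddMeas.mul (hf : BddMeas f) (hg : BddMeas g) : BddMeas (fun x => f x * g x) := by
  obtain ⟨hf1, K, hK⟩ := hf
  obtain ⟨hg1, L, hL⟩ := hg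
  refine ⟨hf1.mul hg1, K * L, fun x => ?_⟩
  rw [abs_mul]
  exact mul_le_mul (hK x) (hL x) (abs_nonneg _) ((abs_nonneg _).trans (hK x))

theorem BddMeas.const (c : ℝ) : BddMeas (fun _ : E => c) :=
  ⟨measurable_const, |c|, fun _ => le_rfl⟩

theorem BddMeas.of_mem_Icc (hf : Measurable f) {a b : ℝ} (h : ∀ x, f x ∈ Set.Icc a b) :
    BddMeas f :=
  ⟨hf, |a| + |b|, fun x => (abs_le_max_abs_abs (h x).1 (h x).2).trans
      (max_le (le_add_of_nonneg_right (abs_nonneg _)) (le_add_of_nonneg_left (abs_nonneg _)))⟩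

theorem BddMeas.comp {E' : Type*} [MeasurableSpace E'] (hf : BddMeas f) {φ : E' → E}
    (hφ : Measurable φ) : BddMeas (fun x => f (φ x)) :=
  ⟨hf.1.comp hφ, hf.2.imp fun _ h x => h (φ x)⟩

theorem BddMeas.prod {ι : Type*} {E : Type*} [MeasurableSpace E] (s : Finset ι) {f : ι → E → ℝ}
    (hf : ∀ i, BddMeas (f i)) : BddMeas (fun x => ∏ i ∈ s, f i x) := by
  classical
  induction s using Finset.induction_on with
  | empty => simpa using BddMeas.const 1
  | insert a s ha ih => simpa only [Finset.prod_insert ha] using (hf a).mul ih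

theorem BddMeas.integral_kernel {E' : Type*} [MeasurableSpace E'] (hf : BddMeas f)
    (κ : Kernel E' E) [IsMarkovKernel κ] : BddMeas (fun x => ∫ e, f e ∂(κ x)) := by
  refine ⟨(hf.1.stronglyMeasurable.integral_kernel).measurable, ?_⟩
  obtain ⟨hf1, K, hK⟩ := hf
  refine ⟨K, fun x => ?_⟩
  have := norm_integral_le_of_norm_le_const (μ := κ x) (f := f) (C := K)
    (Filter.Eventually.of_forall hK)
  simpa using this

end BddMeas

namespace StateSpaceModel

variable (S : StateSpaceModel X Y)

theorem bddMeas_lookahead {f : ℕ → X → ℝ} (hf : ∀ t, BddMeas (f t)) (t k : ℕ) :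
    BddMeas (S.lookahead f t k) := by
  induction k generalizing t with
  | zero => exact BddMeas.const 1
  | succ k ih => exact ((hf (t + 1)).mul (ih (t + 1))).integral_kernel S.M

theorem lookahead_congr {f f' : ℕ → X → ℝ} (t k : ℕ) (h : ∀ u, t < u → f u = f' u) :
    S.lookahead f t k = S.lookahead f' t k := by
  induction k generalizing t with
  | zero => rfl
  | succ k ih =>
    ext x
    simp only [lookahead]
    rw [h (t + 1) (by omega), ih (t + 1) fun u hu => h u (by omega)]

instance isProbabilityMeasure_pathMeasure (n : ℕ) : IsProbabilityMeasure (S.pathMeasure n) := by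
  induction n with
  | zero =>
    exact Measure.isProbabilityMeasure_map (by fun_prop)
  | succ n ih =>
    refine Measure.isProbabilityMeasure_map (Measurable.aemeasurable ?_)
    exact measurable_pi_iff.2 fun i => by
      refine Fin.lastCases ?_ (fun j => ?_) i
      · simpa using measurable_snd
      · simp only [Fin.snoc_castSucc]
        fun_prop

theorem integral_pathMeasure_succ {n : ℕ} {F : (Fin (n + 1) → X) → ℝ} {f : X → ℝ}
    (hF : BddMeas F) (hf : BddMeas f) :
    ∫ x, F (fun i => x i.castSucc) * f (x (Fin.last (n + 1))) ∂(S.pathMeasure (n + 1))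
      = ∫ x, F x * ∫ x', f x' ∂(S.M (x (Fin.last n))) ∂(S.pathMeasure n) := by
  have hsnoc : Measurable (fun z : (Fin (n + 1) → X) × X =>
      Fin.snoc (α := fun _ => X) z.1 z.2) :=
    measurable_pi_iff.2 fun i => by
      refine Fin.lastCases ?_ (fun j => ?_) i
      · simpa using measurable_snd
      · simp only [Fin.snoc_castSucc]
        fun_prop
  have hF' : BddMeas (fun x : Fin (n + 2) → X =>
      F (fun i => x i.castSucc) * f (x (Fin.last (n + 1)))) :=
    (hF.comp (by fun_prop)).mul (hf.comp (by fun_prop))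
  have hG : BddMeas (fun z : (Fin (n + 1) → X) × X => F z.1 * f z.2) :=
    (hF.comp measurable_fst).mul (hf.comp measurable_snd)
  rw [pathMeasure, integral_map hsnoc.aemeasurable hF'.1.aestronglyMeasurable]
  simp only [Fin.snoc_castSucc, Fin.snoc_last]
  rw [Measure.integral_compProd (hG.integrable _)]
  simp only [Kernel.comap_apply, integral_const_mul]

/-- Integrating out the last coordinate of the path trades one unit of `n` for one unit of `k`. -/
theorem integral_prod_mul_lookahead {f : ℕ → X → ℝ} (hf : ∀ t, BddMeas (f t)) (n k : ℕ) :
    ∫ x, (∏ u : Fin (n + 1), f u (x u)) * S.lookahead f n k (x (Fin.last n)) ∂(S.pathMeasure n)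
      = ∫ x, f 0 x * S.lookahead f 0 (n + k) x ∂S.χ := by
  induction n generalizing k with
  | zero =>
    have hm : BddMeas (fun x : Fin 1 → X =>
        (∏ u : Fin 1, f u (x u)) * S.lookahead f 0 k (x (Fin.last 0))) :=
      (BddMeas.prod _ fun i => (hf _).comp (measurable_pi_apply i)).mul
        ((S.bddMeas_lookahead hf 0 k).comp (measurable_pi_apply _))
    rw [pathMeasure, integral_map (by fun_prop) hm.1.aestronglyMeasurable]
    simp
  | succ n ih =>
    have h1 := S.integral_pathMeasure_succ (n := n)
      (F := fun x => ∏ u : Fin (n + 1), f u (x u))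
      (f := fun x => f (n + 1) x * S.lookahead f (n + 1) k x)
      (BddMeas.prod _ fun i => (hf _).comp (measurable_pi_apply i))
      ((hf _).mul (S.bddMeas_lookahead hf _ _))
    rw [show n + 1 + k = n + (k + 1) by ring, ← ih (k + 1)]
    refine Eq.trans ?_ h1
    refine integral_congr_ae (Filter.Eventually.of_forall fun x => ?_)
    simp only [Fin.prod_univ_castSucc (n := n + 1), Fin.val_castSucc, Fin.val_last]
    ring

theorem integral_prod_pathMeasure {f : ℕ → X → ℝ} (hf : ∀ t, BddMeas (f t)) (n : ℕ) :
    ∫ x, (∏ u : Fin (n + 1), f u (x u)) ∂(S.pathMeasure n)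
      = ∫ x, f 0 x * S.lookahead f 0 n x ∂S.χ := by
  simpa [lookahead] using S.integral_prod_mul_lookahead hf n 0

/-- Absorbing `h` into the likelihood at time `s` makes the numerator a product of functions of one
coordinate, so the same recursion evaluates numerator and denominator. -/
theorem smoothing_eq {y : ℕ → Y} (hg : ∀ t, BddMeas (S.lik y t)) {h : X → ℝ} (hh : BddMeas h)
    (T : ℕ) (s : Fin (T + 1)) :
    S.smoothing y T s h = (∫ x, S.likAt y s h 0 x * S.lookahead (S.likAt y s h) 0 T x ∂S.χ) /
      ∫ x, S.lik y 0 x * S.lookahead (S.lik y) 0 T x ∂S.χ := by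
  have hg' : ∀ t, BddMeas (S.likAt y s h t) := by
    intro t
    unfold likAt
    split_ifs
    exacts [(hg t).mul hh, hg t]
  rw [← S.integral_prod_pathMeasure hg, ← S.integral_prod_pathMeasure hg']
  unfold smoothing jointSmoothing
  congr 1
  refine integral_congr_ae (Filter.Eventually.of_forall fun x => ?_)
  simp only
  rw [← Finset.mul_prod_erase _ _ (Finset.mem_univ s),
    ← Finset.mul_prod_erase Finset.univ (fun u : Fin (T + 1) => S.likAt y s h u (x u))
      (Finset.mem_univ s)]
  have : ∀ u ∈ Finset.univ.erase s, S.likAt y s h u (x u) = (S.g (x u) (y u) : ℝ) := by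
    intro u hu
    rw [likAt, if_neg (fun e => Finset.ne_of_mem_erase hu (Fin.ext e))]
    rfl
  rw [Finset.prod_congr rfl this, likAt, if_pos rfl, lik]
  ring

theorem integral_M (x : X) (F : X → ℝ) :
    ∫ x', F x' ∂(S.M x) = ∫ x', (S.m x x' : ℝ) * F x' ∂S.ν := by
  rw [S.M_eq, integral_withDensity_eq_integral_smul]
  · rfl
  · exact S.measurable_m.comp (by fun_prop : Measurable fun x' => (x, x'))

end StateSpaceModel

end

/-! ### Consequences of strong mixing for the look-ahead functions -/

noncomputable section

variable {X Y : Type*} [MeasurableSpace X] [MeasurableSpace Y]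

/-- The strong mixing and bounded likelihood conditions, with real constants. -/
structure StateSpaceModel.MixingWith (S : StateSpaceModel X Y) (y : ℕ → Y) (a b c G : ℝ) :
    Prop where
  a_pos : 0 < a
  c_pos : 0 < c
  m_mem : ∀ x x', (S.m x x' : ℝ) ∈ Set.Icc a b
  lik_pos : ∀ t x, 0 < S.lik y t x
  lik_le : ∀ t x, S.lik y t x ≤ G
  le_init : c ≤ ∫ x, S.lik y 0 x ∂S.χ
  le_step : ∀ t x, c ≤ ∫ x', S.lik y (t + 1) x' ∂(S.M x)

theorem StateSpaceModel.exists_mixingWith {S : StateSpaceModel X Y} {y : ℕ → Y}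
    (hlik : S.BoundedLikelihood y) (hmix : S.StrongMixing y) :
    ∃ a b c G : ℝ, S.MixingWith y a b c G := by
  obtain ⟨hpos, hsup⟩ := hlik
  obtain ⟨⟨a, b, ha, -, hm⟩, c, hc, hc0, hc1⟩ := hmix
  set Gt := ⨆ t, ⨆ x, (S.g x (y t) : ℝ≥0∞) with hGt
  have hle : ∀ t x, (S.g x (y t) : ℝ≥0∞) ≤ Gt := fun t x =>
    (le_iSup (fun x => (S.g x (y t) : ℝ≥0∞)) x).trans
      (le_iSup (fun t => ⨆ x, (S.g x (y t) : ℝ≥0∞)) t)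
  have hgm : ∀ t, Measurable (fun x => S.g x (y t)) := fun t =>
    S.measurable_g.comp (by fun_prop : Measurable fun x => (x, y t))
  have hG : ∀ t x, S.lik y t x ≤ Gt.toReal := fun t x => by
    have := ENNReal.toReal_mono hsup.ne (hle t x)
    simpa [lik] using this
  have conv : ∀ (t : ℕ) (μ : Measure X) [IsProbabilityMeasure μ],
      (c : ℝ≥0∞) ≤ ∫⁻ x, (S.g x (y t) : ℝ≥0∞) ∂μ → (c : ℝ) ≤ ∫ x, S.lik y t x ∂μ := by
    intro t μ _ h
    have hfin : ∫⁻ x, (S.g x (y t) : ℝ≥0∞) ∂μ ≠ ⊤ := by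
      refine ((lintegral_mono fun x => hle t x).trans_lt ?_).ne
      simpa using hsup
    have h1 := ENNReal.toReal_mono hfin h
    unfold lik
    rw [integral_eq_lintegral_of_nonneg_ae
      (Filter.Eventually.of_forall fun x => NNReal.coe_nonneg _)
      (hgm t).coe_nnreal_real.aestronglyMeasurable]
    simpa using h1
  refine ⟨a, b, c, Gt.toReal, ⟨by exact_mod_cast ha, by exact_mod_cast hc,
    fun x x' => ⟨by exact_mod_cast (hm x x').1, by exact_mod_cast (hm x x').2⟩,
    fun t x => by exact_mod_cast hpos t x, hG, conv 0 _ hc0, fun t x => conv _ _ ?_⟩⟩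
  exact (hc1 (t + 1) (by omega)).trans (iInf_le _ x)

namespace StateSpaceModel.MixingWith

variable {S : StateSpaceModel X Y} {y : ℕ → Y} {a b c G : ℝ}

theorem m_pos (hS : S.MixingWith y a b c G) (x x' : X) : 0 < (S.m x x' : ℝ) :=
  hS.a_pos.trans_le (hS.m_mem x x').1

theorem a_le_b (hS : S.MixingWith y a b c G) : a ≤ b := by
  obtain ⟨x⟩ : Nonempty X := S.χ.nonempty_of_neZero
  exact (hS.m_mem x x).1.trans (hS.m_mem x x).2

theorem b_pos (hS : S.MixingWith y a b c G) : 0 < b := hS.a_pos.trans_le hS.a_le_b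

theorem bddMeas_lik (hS : S.MixingWith y a b c G) (t : ℕ) : BddMeas (S.lik y t) :=
  BddMeas.of_mem_Icc (a := 0) (b := G)
    (S.measurable_g.comp (by fun_prop : Measurable fun x => (x, y t))).coe_nnreal_real
    fun x => ⟨(hS.lik_pos t x).le, hS.lik_le t x⟩

theorem bddMeas_likAt (hS : S.MixingWith y a b c G) {h : X → ℝ} (hh : BddMeas h) (s t : ℕ) :
    BddMeas (S.likAt y s h t) := by
  unfold likAt
  split_ifs
  exacts [(hS.bddMeas_lik t).mul hh, hS.bddMeas_lik t]

/-- From `1 = M(x, X) ≥ a ν(X)`. Bounded functions thereby become `ν`-integrable. -/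
theorem isFiniteMeasure_ν (hS : S.MixingWith y a b c G) : IsFiniteMeasure S.ν := by
  obtain ⟨x⟩ : Nonempty X := S.χ.nonempty_of_neZero
  have h1 : ENNReal.ofReal a * S.ν Set.univ ≤ 1 := by
    have h2 : S.M x Set.univ = 1 := measure_univ
    rw [S.M_eq, withDensity_apply _ MeasurableSet.univ, setLIntegral_univ] at h2
    rw [← h2, ← lintegral_const]
    refine lintegral_mono fun x' => ?_
    rw [← ENNReal.ofReal_coe_nnreal]
    exact ENNReal.ofReal_le_ofReal (hS.m_mem x x').1
  refine ⟨?_⟩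
  by_contra hcon
  rw [not_lt, top_le_iff] at hcon
  rw [hcon, ENNReal.mul_top (by simpa using hS.a_pos)] at h1
  simp at h1

theorem bddMeas_lookahead_lik (hS : S.MixingWith y a b c G) (t k : ℕ) :
    BddMeas (S.lookahead (S.lik y) t k) :=
  S.bddMeas_lookahead hS.bddMeas_lik t k

/-- A step back in time costs one factor `c`. Combined with the Harnack inequality, it compares
consecutive look-ahead functions with a constant free of the horizon. -/
theorem le_lookahead_succ (hS : S.MixingWith y a b c G) {t k : ℕ} {l : ℝ} (hl : 0 ≤ l)
    (h : ∀ x, l ≤ S.lookahead (S.lik y) (t + 1) k x) (x : X) :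
    c * l ≤ S.lookahead (S.lik y) t (k + 1) x := by
  calc c * l ≤ (∫ x', S.lik y (t + 1) x' ∂(S.M x)) * l := by
        gcongr
        exact hS.le_step t x
    _ = ∫ x', S.lik y (t + 1) x' * l ∂(S.M x) := by rw [integral_mul_const]
    _ ≤ _ := integral_mono (((hS.bddMeas_lik _).mul (BddMeas.const l)).integrable _)
        (((hS.bddMeas_lik _).mul (hS.bddMeas_lookahead_lik _ _)).integrable _)
        fun x' => mul_le_mul_of_nonneg_left (h x') (hS.lik_pos _ _).le

theorem le_integral_init (hS : S.MixingWith y a b c G) {k : ℕ} {l : ℝ} (hl : 0 ≤ l)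
    (h : ∀ x, l ≤ S.lookahead (S.lik y) 0 k x) :
    c * l ≤ ∫ x, S.lik y 0 x * S.lookahead (S.lik y) 0 k x ∂S.χ := by
  calc c * l ≤ (∫ x', S.lik y 0 x' ∂S.χ) * l := by
        gcongr
        exact hS.le_init
    _ = ∫ x', S.lik y 0 x' * l ∂S.χ := by rw [integral_mul_const]
    _ ≤ _ := integral_mono (((hS.bddMeas_lik _).mul (BddMeas.const l)).integrable _)
        (((hS.bddMeas_lik _).mul (hS.bddMeas_lookahead_lik _ _)).integrable _)
        fun x' => mul_le_mul_of_nonneg_left (h x') (hS.lik_pos _ _).le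

theorem lookahead_nonneg (hS : S.MixingWith y a b c G) (t k : ℕ) (x : X) :
    0 ≤ S.lookahead (S.lik y) t k x := by
  induction k generalizing t x with
  | zero => exact zero_le_one
  | succ k ih => exact integral_nonneg fun x' => mul_nonneg (hS.lik_pos _ _).le (ih _ _)

/-- Only the first transition depends on the starting point, and its density changes at most by the
factor `b / a`. The number of remaining steps plays no role. -/
theorem lookahead_harnack (hS : S.MixingWith y a b c G) (t k : ℕ) (x x' : X) :
    S.lookahead (S.lik y) t k x ≤ b / a * S.lookahead (S.lik y) t k x' := by
  have := hS.isFiniteMeasure_ν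
  have hab : 1 ≤ b / a := (one_le_div hS.a_pos).2 hS.a_le_b
  cases k with
  | zero => simpa [lookahead] using hab
  | succ k =>
    simp only [lookahead, integral_M]
    have hB : BddMeas fun z => S.lik y (t + 1) z * S.lookahead (S.lik y) (t + 1) k z :=
      (hS.bddMeas_lik _).mul (hS.bddMeas_lookahead_lik _ _)
    have hm : ∀ x, BddMeas fun z => (S.m x z : ℝ) := fun x =>
      BddMeas.of_mem_Icc
        (S.measurable_m.comp (by fun_prop : Measurable fun x' => (x, x'))).coe_nnreal_real
        (hS.m_mem x)
    rw [← integral_const_mul]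
    refine integral_mono (((hm x).mul hB).integrable _)
      ((((hm x').mul hB).integrable _).const_mul _) fun z => ?_
    simp only
    rw [← mul_assoc (b / a)]
    have h0 : 0 ≤ S.lik y (t + 1) z * S.lookahead (S.lik y) (t + 1) k z :=
      mul_nonneg (hS.lik_pos _ _).le (hS.lookahead_nonneg _ _ _)
    refine mul_le_mul_of_nonneg_right ((hS.m_mem x z).2.trans ?_) h0
    rw [div_mul_eq_mul_div, le_div_iff₀ hS.a_pos]
    exact mul_le_mul_of_nonneg_left (hS.m_mem x' z).1 hS.b_pos.le

/-- Harnack turns positivity at one point into a uniform lower bound, which `le_lookahead_succ`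
carries one step back. -/
theorem lookahead_pos (hS : S.MixingWith y a b c G) (t k : ℕ) (x : X) :
    0 < S.lookahead (S.lik y) t k x := by
  induction k generalizing t x with
  | zero => exact zero_lt_one
  | succ k ih =>
    have hab : 0 < b / a := div_pos hS.b_pos hS.a_pos
    refine lt_of_lt_of_le ?_ (hS.le_lookahead_succ
      (l := S.lookahead (S.lik y) (t + 1) k x / (b / a)) (div_pos (ih _ _) hab).le
      (fun x' => ?_) x)
    · exact mul_pos hS.c_pos (div_pos (ih _ _) hab)
    · rw [div_le_iff₀' hab]
      exact hS.lookahead_harnack _ _ _ _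

end StateSpaceModel.MixingWith

/-! ### The conditional smoother and its range -/

variable {N : ℕ}

/-- The backward iterates of the empirical measures of a flow `η` of weighted samples. -/
def StateSpaceModel.sampleBackward (S : StateSpaceModel X Y) (η : ℕ → Fin N → X × ℝ≥0) (s : ℕ)
    (h : X → ℝ) : ℕ → X → ℝ
  | 0, x => h x
  | n + 1, x =>
    (∑ i, (S.m (η (s + n) i).1 x : ℝ) * (η (s + n) i).2 *
      S.sampleBackward η s h n (η (s + n) i).1) /
    ∑ i, (S.m (η (s + n) i).1 x : ℝ) * (η (s + n) i).2

/-- The conditional expectation of `h(X_s)` given `X_t` and the observations up to time `T`, where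
the backward kernels are those of the flow `η` of weighted samples. -/
def StateSpaceModel.condSmoother (S : StateSpaceModel X Y) (y : ℕ → Y) (T s : ℕ) (h : X → ℝ)
    (η : ℕ → Fin N → X × ℝ≥0) (t : ℕ) (x : X) : ℝ :=
  if t < s then
    S.lookahead (S.likAt y s h) t (T - t) x / S.lookahead (S.lik y) t (T - t) x
  else S.sampleBackward η s h (t - s) x

/-- The time distance `|t - s|`. -/
def gap (s t : ℕ) : ℕ := (t - s) + (s - t)

namespace StateSpaceModel

variable (S : StateSpaceModel X Y)

theorem measurable_sampleBackward (s : ℕ) {h : X → ℝ} (hh : Measurable h) (n : ℕ) :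
    Measurable (fun p : (ℕ → Fin N → X × ℝ≥0) × X => S.sampleBackward p.1 s h n p.2) := by
  induction n with
  | zero => exact hh.comp measurable_snd
  | succ n ih =>
    simp only [sampleBackward]
    have hm : ∀ i : Fin N, Measurable (fun p : (ℕ → Fin N → X × ℝ≥0) × X =>
        (S.m (p.1 (s + n) i).1 p.2 : ℝ) * (p.1 (s + n) i).2) := fun i =>
      (S.measurable_m.comp (by fun_prop : Measurable fun p : (ℕ → Fin N → X × ℝ≥0) × X =>
        ((p.1 (s + n) i).1, p.2))).coe_nnreal_real.mul
        (by fun_prop : Measurable fun p : (ℕ → Fin N → X × ℝ≥0) × X =>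
          (p.1 (s + n) i).2).coe_nnreal_real
    refine Measurable.div (Finset.measurable_sum _ fun i _ => (hm i).mul ?_)
      (Finset.measurable_sum _ fun i _ => hm i)
    exact ih.comp (by fun_prop : Measurable fun p : (ℕ → Fin N → X × ℝ≥0) × X =>
      (p.1, (p.1 (s + n) i).1))

theorem sampleBackward_congr {η η' : ℕ → Fin N → X × ℝ≥0} (s : ℕ) (h : X → ℝ) (n : ℕ)
    (hη : ∀ u, u < s + n → η u = η' u) : S.sampleBackward η s h n = S.sampleBackward η' s h n := by
  induction n with
  | zero => rfl
  | succ n ih =>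
    ext x
    simp only [sampleBackward]
    rw [hη (s + n) (by omega), ih fun u hu => hη u (by omega)]

/-- Predictability: the function at time `t` uses only samples strictly before `t`. Given the
history up to `t`, the integrand at time `t + 1` is therefore a fixed function. -/
theorem condSmoother_congr (y : ℕ → Y) (T s : ℕ) (h : X → ℝ) {η η' : ℕ → Fin N → X × ℝ≥0} {t : ℕ}
    (hη : ∀ u, u < t → η u = η' u) :
    S.condSmoother y T s h η t = S.condSmoother y T s h η' t := by
  ext x
  unfold condSmoother
  split_ifs with hts
  · rfl
  · rw [S.sampleBackward_congr s h (t - s) fun u hu => hη u (by omega)]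

theorem condSmoother_self (y : ℕ → Y) (T s : ℕ) (h : X → ℝ) (η : ℕ → Fin N → X × ℝ≥0) :
    S.condSmoother y T s h η s = h := by
  ext x
  simp [condSmoother, sampleBackward]

theorem condSmoother_succ (y : ℕ → Y) {T s t : ℕ} (h : X → ℝ) (η : ℕ → Fin N → X × ℝ≥0)
    (hst : s ≤ t) (x : X) :
    S.condSmoother y T s h η (t + 1) x =
      (∑ i, (S.m (η t i).1 x : ℝ) * (η t i).2 * S.condSmoother y T s h η t (η t i).1) /
        ∑ i, (S.m (η t i).1 x : ℝ) * (η t i).2 := by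
  obtain ⟨n, rfl⟩ := Nat.exists_eq_add_of_le hst
  have e1 : ¬ s + n < s := by omega
  have e2 : ¬ s + n + 1 < s := by omega
  simp only [condSmoother, if_neg e1, if_neg e2, Nat.add_sub_cancel_left,
    show s + n + 1 - s = n + 1 by omega, sampleBackward]

namespace MixingWith

variable {S} {y : ℕ → Y} {a b c G : ℝ}

theorem measurable_condSmoother (hS : S.MixingWith y a b c G) {T s : ℕ} {h : X → ℝ}
    (hh : BddMeas h) (t : ℕ) :
    Measurable (fun p : (ℕ → Fin N → X × ℝ≥0) × X => S.condSmoother y T s h p.1 t p.2) := by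
  unfold condSmoother
  split_ifs
  · exact ((S.bddMeas_lookahead (hS.bddMeas_likAt hh s) t (T - t)).1.comp measurable_snd).div
      ((hS.bddMeas_lookahead_lik t (T - t)).1.comp measurable_snd)
  · exact S.measurable_sampleBackward s hh.1 _

/-- Before time `s`, the conditional smoother solves the forward recursion. -/
theorem condSmoother_mul_lookahead (hS : S.MixingWith y a b c G) {T s t : ℕ} (h : X → ℝ)
    (η : ℕ → Fin N → X × ℝ≥0) (hts : t < s) (hsT : s ≤ T) (x : X) :
    S.condSmoother y T s h η t x * S.lookahead (S.lik y) t (T - t) x =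
      ∫ x', S.lik y (t + 1) x' * S.lookahead (S.lik y) (t + 1) (T - (t + 1)) x' *
        S.condSmoother y T s h η (t + 1) x' ∂(S.M x) := by
  rw [condSmoother, if_pos hts, div_mul_cancel₀ _ (hS.lookahead_pos _ _ _).ne']
  obtain ⟨k, hk⟩ : ∃ k, T - t = k + 1 := ⟨T - t - 1, by omega⟩
  rw [hk, show T - (t + 1) = k by omega]
  simp only [lookahead]
  refine integral_congr_ae (Filter.Eventually.of_forall fun x' => ?_)
  simp only
  rcases Nat.lt_or_ge (t + 1) s with h1 | h1
  · rw [condSmoother, if_pos h1, show T - (t + 1) = k by omega, likAt, if_neg h1.ne]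
    have := (hS.lookahead_pos (t + 1) k x').ne'
    field_simp
  · obtain rfl : s = t + 1 := by omega
    rw [condSmoother_self, likAt, if_pos rfl,
      S.lookahead_congr (f' := S.lik y) (t + 1) k fun u hu => ?_]
    · ring
    · ext z
      rw [likAt, if_neg hu.ne']

/-- Moving away from `s` in either direction averages with a kernel of density in `[a, b]` up to
normalization, so each step contracts the range by `1 - a / b`. The slack `κ` allows a positive rate
even when `a = b`. -/
theorem exists_Icc_condSmoother (hS : S.MixingWith y a b c G) {T s : ℕ} {h : X → ℝ}
    (hh : Measurable h) {lo o κ : ℝ} (ho : 0 ≤ o) (hho : ∀ x, h x ∈ Set.Icc lo (lo + o))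
    (hκ : 1 - a / b ≤ κ) (hsT : s ≤ T) {η : ℕ → Fin N → X × ℝ≥0} (t : ℕ)
    (hη : ∀ u, u < t → 0 < ∑ i, (η u i).2) :
    ∃ lo', ∀ x, S.condSmoother y T s h η t x ∈ Set.Icc lo' (lo' + κ ^ gap s t * o) := by
  have := hS.isFiniteMeasure_ν
  have hBh : BddMeas h := BddMeas.of_mem_Icc hh hho
  have hκ0 : 0 ≤ κ := by
    have := (div_le_one hS.b_pos).2 hS.a_le_b
    linarith
  have hmeas : ∀ t, Measurable (S.condSmoother y T s h η t) := fun t =>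
    (hS.measurable_condSmoother hBh t).comp (by fun_prop : Measurable fun x => (η, x))
  have widen : ∀ {z l : ℝ} {n : ℕ}, z ∈ Set.Icc l (l + (1 - a / b) * (κ ^ n * o)) →
      z ∈ Set.Icc l (l + κ ^ (n + 1) * o) := by
    intro z l n hz
    refine ⟨hz.1, hz.2.trans ?_⟩
    rw [pow_succ']
    have : (1 - a / b) * (κ ^ n * o) ≤ κ * (κ ^ n * o) := by gcongr
    linarith
  -- Times after `s`: Doeblin contraction for counting measure on the particle indices, with `v` the
  -- importance weights.
  have back : ∀ n, (∀ u, u < s + n → 0 < ∑ i, (η u i).2) →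
      ∃ lo', ∀ x, S.condSmoother y T s h η (s + n) x ∈ Set.Icc lo' (lo' + κ ^ n * o) := by
    intro n
    induction n with
    | zero => exact fun _ => ⟨lo, fun x => by simpa [condSmoother_self] using hho x⟩
    | succ n ih =>
      intro hη
      obtain ⟨l, hl⟩ := ih fun u hu => hη u (by omega)
      have hpos : (0 : ℝ) < ∑ i, ((η (s + n) i).2 : ℝ) := by
        exact_mod_cast hη (s + n) (by omega)
      obtain ⟨l', hl'⟩ := exists_Icc_weighted_mean (Measure.count : Measure (Fin N))
        (k := fun (x : X) i => (S.m (η (s + n) i).1 x : ℝ)) (v := fun i => ((η (s + n) i).2 : ℝ))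
        (f := fun i => S.condSmoother y T s h η (s + n) (η (s + n) i).1)
        (fun x => measurable_of_finite _) hS.a_pos (fun x e => hS.m_mem _ _)
        (Integrable.of_finite) (fun e => NNReal.coe_nonneg _) (by simpa using hpos)
        (measurable_of_finite _) (fun e => hl _)
      refine ⟨l', fun x => widen ?_⟩
      rw [show s + (n + 1) = s + n + 1 by ring, condSmoother_succ S y h η (by omega)]
      simpa using hl' x
  -- Times before `s`: Doeblin contraction for `ν`, with `v` the likelihood times the look-ahead
  -- function at the following time.
  have forw : ∀ n, n ≤ s →
      ∃ lo', ∀ x, S.condSmoother y T s h η (s - n) x ∈ Set.Icc lo' (lo' + κ ^ n * o) := by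
    intro n
    induction n with
    | zero => exact fun _ => ⟨lo, fun x => by simpa [condSmoother_self] using hho x⟩
    | succ n ih =>
      intro hn
      obtain ⟨l, hl⟩ := ih (by omega)
      obtain ⟨t, ht⟩ : ∃ t, s - n = t + 1 := ⟨s - n - 1, by omega⟩
      rw [ht] at hl
      rw [show s - (n + 1) = t by omega]
      set v : X → ℝ := fun x' => S.lik y (t + 1) x' * S.lookahead (S.lik y) (t + 1) (T - (t + 1)) x'
        with hv
      have hvB : BddMeas v := (hS.bddMeas_lik _).mul (hS.bddMeas_lookahead_lik _ _)
      have hlook : ∀ x, S.lookahead (S.lik y) t (T - t) x = ∫ x', (S.m x x' : ℝ) * v x' ∂S.ν := by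
        intro x
        rw [show T - t = (T - (t + 1)) + 1 by omega]
        simp only [lookahead, integral_M, hv]
      have hm : ∀ x : X, Measurable fun z => (S.m x z : ℝ) := fun x =>
        (S.measurable_m.comp (by fun_prop : Measurable fun x' => (x, x'))).coe_nnreal_real
      have hv0 : ∀ x, 0 ≤ v x := fun x =>
        mul_nonneg (hS.lik_pos _ _).le (hS.lookahead_pos _ _ _).le
      have hvpos : 0 < ∫ x', v x' ∂S.ν := by
        obtain ⟨x⟩ : Nonempty X := S.χ.nonempty_of_neZero
        have h1 := hS.lookahead_pos t (T - t) x
        rw [hlook] at h1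
        have h2 : ∫ x', (S.m x x' : ℝ) * v x' ∂S.ν ≤ b * ∫ x', v x' ∂S.ν := by
          rw [← integral_const_mul]
          exact integral_mono (((BddMeas.of_mem_Icc (hm x) (hS.m_mem x)).mul hvB).integrable _)
            ((hvB.integrable _).const_mul _)
            fun z => mul_le_mul_of_nonneg_right (hS.m_mem x z).2 (hv0 z)
        exact pos_of_mul_pos_right (h1.trans_le h2) hS.b_pos.le
      obtain ⟨l', hl'⟩ := exists_Icc_weighted_mean S.ν (k := fun x x' => (S.m x x' : ℝ)) (v := v)
        (f := S.condSmoother y T s h η (t + 1)) hm hS.a_pos hS.m_mem (hvB.integrable _) hv0 hvpos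
        (hmeas _) hl
      refine ⟨l', fun x => widen ?_⟩
      have e := hS.condSmoother_mul_lookahead h η (show t < s by omega) hsT x
      rw [← eq_div_iff (hS.lookahead_pos _ _ _).ne', hlook, integral_M] at e
      rw [e]
      simpa only [mul_assoc, hv] using hl' x
  rcases Nat.le_total s t with hst | hst
  · obtain ⟨n, rfl⟩ := Nat.exists_eq_add_of_le hst
    rw [show gap s (s + n) = n by unfold gap; omega]
    exact back n hη
  · have := forw (s - t) (by omega)
    rwa [show s - (s - t) = t by omega, show s - t = gap s t by unfold gap; omega] at this

end MixingWith

end StateSpaceModel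

end

/-! ### Conditional means of one particle step -/

noncomputable section

variable {X Y : Type*} [MeasurableSpace X] [MeasurableSpace Y] {N : ℕ}

namespace StateSpaceModel.MixingWith

variable {S : StateSpaceModel X Y} {y : ℕ → Y} {a b c G : ℝ}

/-- Consistency of the conditional smoothers with one forward step from a weighted sample. -/
theorem sum_integral_condSmoother (hS : S.MixingWith y a b c G) {T s t : ℕ} {h : X → ℝ}
    {η : ℕ → Fin N → X × ℝ≥0}
    (hB : BddMeas (S.condSmoother y T s h η (t + 1)))
    (hη : 0 < ∑ i, (η t i).2) (hsT : s ≤ T) (htT : t < T) :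
    ∑ i, ((η t i).2 : ℝ) * ∫ x', S.lik y (t + 1) x' *
        (S.lookahead (S.lik y) (t + 1) (T - (t + 1)) x' * S.condSmoother y T s h η (t + 1) x')
          ∂(S.M (η t i).1)
      = ∑ i, ((η t i).2 : ℝ) * (S.lookahead (S.lik y) t (T - t) (η t i).1 *
          S.condSmoother y T s h η t (η t i).1) := by
  have := hS.isFiniteMeasure_ν
  rcases Nat.lt_or_ge t s with hts | hst
  · refine Finset.sum_congr rfl fun i _ => ?_
    rw [mul_comm (S.lookahead _ _ _ _), hS.condSmoother_mul_lookahead h η hts hsT]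
    simp only [mul_assoc]
  -- From time `s` on, the identity holds only after summation over `i`: under the `ν`-integral the
  -- factor `∑ i, m ω` cancels the denominator of the backward kernel in the smoother at `t + 1`.
  · set v : X → ℝ := fun x' => S.lik y (t + 1) x' * S.lookahead (S.lik y) (t + 1) (T - (t + 1)) x'
      with hv
    have hvB : BddMeas v := (hS.bddMeas_lik _).mul (hS.bddMeas_lookahead_lik _ _)
    have hlook : ∀ x, S.lookahead (S.lik y) t (T - t) x = ∫ x', (S.m x x' : ℝ) * v x' ∂S.ν := by
      intro x
      rw [show T - t = (T - (t + 1)) + 1 by omega]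
      simp only [lookahead, integral_M, hv]
    have hm : ∀ x : X, BddMeas fun z => (S.m x z : ℝ) := fun x => BddMeas.of_mem_Icc
      (S.measurable_m.comp (by fun_prop : Measurable fun x' => (x, x'))).coe_nnreal_real
      (hS.m_mem x)
    have hL : ∀ i, ((η t i).2 : ℝ) * ∫ x', S.lik y (t + 1) x' *
        (S.lookahead (S.lik y) (t + 1) (T - (t + 1)) x' * S.condSmoother y T s h η (t + 1) x')
          ∂(S.M (η t i).1) = ∫ x', (S.m (η t i).1 x' : ℝ) * (η t i).2 *
            (v x' * S.condSmoother y T s h η (t + 1) x') ∂S.ν := by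
      intro i
      rw [integral_M, ← integral_const_mul]
      refine integral_congr_ae (Filter.Eventually.of_forall fun x' => ?_)
      simp only [hv]
      ring
    have hR : ∀ i, ((η t i).2 : ℝ) * (S.lookahead (S.lik y) t (T - t) (η t i).1 *
          S.condSmoother y T s h η t (η t i).1) =
          ∫ x', (S.m (η t i).1 x' : ℝ) * (η t i).2 * S.condSmoother y T s h η t (η t i).1 *
            v x' ∂S.ν := by
      intro i
      rw [hlook, ← integral_mul_const, ← integral_const_mul]
      refine integral_congr_ae (Filter.Eventually.of_forall fun x' => ?_)
      simp only
      ring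
    simp only [hL, hR]
    rw [← integral_finsetSum, ← integral_finsetSum]
    · refine integral_congr_ae (Filter.Eventually.of_forall fun x => ?_)
      simp only
      rw [← Finset.sum_mul, ← Finset.sum_mul, condSmoother_succ S y h η hst]
      have hpos : 0 < ∑ i, (S.m (η t i).1 x : ℝ) * (η t i).2 := by
        have h1 : ∑ i, a * ((η t i).2 : ℝ) ≤ ∑ i, (S.m (η t i).1 x : ℝ) * (η t i).2 :=
          Finset.sum_le_sum fun i _ =>
            mul_le_mul_of_nonneg_right (hS.m_mem _ _).1 (NNReal.coe_nonneg _)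
        rw [← Finset.mul_sum] at h1
        refine (mul_pos hS.a_pos ?_).trans_le h1
        exact_mod_cast hη
      field_simp
    · exact fun i _ => ((((hm _).mul (BddMeas.const _)).mul (BddMeas.const _)).mul hvB).integrable _
    · exact fun i _ => (((hm _).mul (BddMeas.const _)).mul (hvB.mul hB)).integrable _

end StateSpaceModel.MixingWith

/-! ### Bounded weights and the instrumental distribution -/

variable {S : StateSpaceModel X Y}

/-- Bounds on the adjustment multipliers and on the importance weights, with real constants. -/
structure FilterDesign.BoundedWith (A : FilterDesign S) (y : ℕ → Y) (W Θ : ℝ) : Prop where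
  W_pos : 0 < W
  one_le : 1 ≤ Θ
  ϑ_le : ∀ t x, (A.ϑ (t + 1) x : ℝ) ≤ Θ
  weightFn₀_le : ∀ x, A.weightFn₀ y x ≤ ENNReal.ofReal W
  weightFn_le : ∀ t x x', A.weightFn y (t + 1) x x' ≤ ENNReal.ofReal W

theorem FilterDesign.exists_boundedWith {A : FilterDesign S} {y : ℕ → Y}
    (hwt : A.BoundedWeights y) : ∃ W Θ : ℝ, A.BoundedWith y W Θ := by
  obtain ⟨h1, h2, h3⟩ := hwt
  set s1 := ⨆ t, ⨆ (_ : 1 ≤ t), ⨆ x, (A.ϑ t x : ℝ≥0∞) with hs1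
  set s2 := ⨆ x, A.weightFn₀ y x with hs2
  set s3 := ⨆ t, ⨆ (_ : 1 ≤ t), ⨆ x, ⨆ x', A.weightFn y t x x' with hs3
  -- The added `1`s make `W` positive and `Θ ≥ 1`; the latter lets time `0`, which has no
  -- multiplier, share the constant of the later times.
  refine ⟨s2.toReal + s3.toReal + 1, s1.toReal + 1, ⟨by positivity, by simp, fun t x => ?_,
    fun x => ?_, fun t x x' => ?_⟩⟩
  · have : (A.ϑ (t + 1) x : ℝ≥0∞) ≤ s1 :=
      le_iSup_of_le (t + 1) (le_iSup_of_le (by omega) (le_iSup_of_le x le_rfl))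
    have h := ENNReal.toReal_mono h1.ne this
    simp only [ENNReal.coe_toReal] at h
    linarith
  · have : A.weightFn₀ y x ≤ s2 := le_iSup_of_le x le_rfl
    rw [← ENNReal.ofReal_toReal h2.ne] at this
    exact this.trans (ENNReal.ofReal_le_ofReal
      (by linarith [ENNReal.toReal_nonneg (a := s3)]))
  · have : A.weightFn y (t + 1) x x' ≤ s3 :=
      le_iSup_of_le (t + 1) (le_iSup_of_le (by omega)
        (le_iSup_of_le x (le_iSup_of_le x' le_rfl)))
    rw [← ENNReal.ofReal_toReal h3.ne] at this
    exact this.trans (ENNReal.ofReal_le_ofReal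
      (by linarith [ENNReal.toReal_nonneg (a := s2)]))

namespace FilterDesign

variable {A : FilterDesign S} {y : ℕ → Y} {W Θ a b c G : ℝ}

theorem measurable_weightFn₀ : Measurable (A.weightFn₀ y) := by
  unfold weightFn₀
  exact A.measurable_r.coe_nnreal_ennreal.mul
    (S.measurable_g.comp (by fun_prop : Measurable fun x => (x, y 0))).coe_nnreal_ennreal

theorem measurable_weightFn (t : ℕ) :
    Measurable (fun p : X × X => A.weightFn y t p.1 p.2) := by
  unfold weightFn
  refine Measurable.div (S.measurable_m.coe_nnreal_ennreal.mul
    (S.measurable_g.comp (by fun_prop : Measurable fun p : X × X =>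
      (p.2, y t))).coe_nnreal_ennreal) ?_
  exact ((A.measurable_ϑ t).comp measurable_fst).coe_nnreal_ennreal.mul
    (A.measurable_p t).coe_nnreal_ennreal

namespace BoundedWith

theorem weightFn₀_toReal_mem (hA : A.BoundedWith y W Θ) (x : X) :
    (A.weightFn₀ y x).toReal ∈ Set.Icc 0 W :=
  ⟨ENNReal.toReal_nonneg, ENNReal.toReal_le_of_le_ofReal hA.W_pos.le (hA.weightFn₀_le x)⟩

theorem weightFn_toReal_mem (hA : A.BoundedWith y W Θ) (t : ℕ) (x x' : X) :
    (A.weightFn y (t + 1) x x').toReal ∈ Set.Icc 0 W :=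
  ⟨ENNReal.toReal_nonneg, ENNReal.toReal_le_of_le_ofReal hA.W_pos.le (hA.weightFn_le t x x')⟩

/-- The numerator `m g` of the weight is positive, so a vanishing denominator would make the weight
infinite. -/
theorem ϑ_mul_p_pos (hA : A.BoundedWith y W Θ) (hS : S.MixingWith y a b c G) (t : ℕ) (x x' : X) :
    0 < A.ϑ (t + 1) x * A.p (t + 1) x x' := by
  rw [pos_iff_ne_zero]
  intro h0
  have h1 := hA.weightFn_le t x x'
  have hm : (S.m x x' : ℝ≥0∞) ≠ 0 := by exact_mod_cast (hS.m_pos x x').ne'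
  have hg : (S.g x' (y (t + 1)) : ℝ≥0∞) ≠ 0 := by
    have := (hS.lik_pos (t + 1) x').ne'
    unfold StateSpaceModel.lik at this
    exact_mod_cast this
  rw [weightFn, ← ENNReal.coe_mul (x := A.ϑ (t + 1) x), h0, ENNReal.coe_zero,
    ENNReal.div_zero (mul_ne_zero hm hg)] at h1
  simp at h1

theorem ϑ_pos (hA : A.BoundedWith y W Θ) (hS : S.MixingWith y a b c G) (t : ℕ) (x : X) :
    0 < A.ϑ (t + 1) x :=
  pos_of_mul_pos_left (hA.ϑ_mul_p_pos hS t x x) (zero_le)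

theorem p_mul_weightFn (hA : A.BoundedWith y W Θ) (hS : S.MixingWith y a b c G) (t : ℕ)
    (x x' : X) : (A.ϑ (t + 1) x : ℝ) * ((A.p (t + 1) x x' : ℝ) *
      (A.weightFn y (t + 1) x x').toReal) = S.m x x' * S.lik y (t + 1) x' := by
  have h1 : (A.ϑ (t + 1) x : ℝ) * A.p (t + 1) x x' ≠ 0 := by
    exact_mod_cast (hA.ϑ_mul_p_pos hS t x x').ne'
  rw [weightFn, ENNReal.toReal_div, ENNReal.toReal_mul, ENNReal.toReal_mul]
  simp only [ENNReal.coe_toReal, StateSpaceModel.lik]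
  rw [← mul_assoc, mul_div_cancel₀ _ h1]

/-- Changing from the proposal kernel to the transition kernel. -/
theorem integral_P (hA : A.BoundedWith y W Θ) (hS : S.MixingWith y a b c G) (t : ℕ) (x : X)
    (F : X → ℝ) :
    (A.ϑ (t + 1) x : ℝ) * ∫ x', (A.weightFn y (t + 1) x x').toReal * F x' ∂(A.P (t + 1) x)
      = ∫ x', S.lik y (t + 1) x' * F x' ∂(S.M x) := by
  rw [S.integral_M, A.P_eq, integral_withDensity_eq_integral_smul, ← integral_const_mul]
  · refine integral_congr_ae (Filter.Eventually.of_forall fun x' => ?_)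
    simp only [NNReal.smul_def, smul_eq_mul]
    have := hA.p_mul_weightFn hS t x x'
    linear_combination F x' * this
  · exact (A.measurable_p (t + 1)).comp (by fun_prop : Measurable fun x' => (x, x'))

theorem integral_ρ₀ (F : X → ℝ) :
    ∫ x, (A.weightFn₀ y x).toReal * F x ∂A.ρ₀ = ∫ x, S.lik y 0 x * F x ∂S.χ := by
  rw [A.χ_eq, integral_withDensity_eq_integral_smul A.measurable_r]
  refine integral_congr_ae (Filter.Eventually.of_forall fun x => ?_)
  simp only [NNReal.smul_def, smul_eq_mul, weightFn₀, ENNReal.toReal_mul, ENNReal.coe_toReal,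
    StateSpaceModel.lik]
  ring

end BoundedWith

section Particles

variable {Ω : Type*} {ξ : ℕ → Fin N → Ω → X} {I : ℕ → Fin N → Ω → Fin N}

theorem sum_weight_mul_ϑ_pos (hA : A.BoundedWith y W Θ) (hS : S.MixingWith y a b c G) {t : ℕ}
    {ω : Ω} (hω : 0 < ∑ i, A.weight y ξ I t i ω) :
    0 < ∑ i, A.weight y ξ I t i ω * A.ϑ (t + 1) (ξ t i ω) := by
  obtain ⟨i, -, hi⟩ := Finset.exists_ne_zero_of_sum_ne_zero hω.ne'
  exact Finset.sum_pos' (fun _ _ => zero_le)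
    ⟨i, Finset.mem_univ _, mul_pos (pos_iff_ne_zero.2 hi) (hA.ϑ_pos hS t _)⟩

theorem isProbabilityMeasure_instrumental (hA : A.BoundedWith y W Θ)
    (hS : S.MixingWith y a b c G) {t : ℕ} {ω : Ω} (hω : 0 < ∑ i, A.weight y ξ I t i ω) :
    IsProbabilityMeasure (A.instrumental y ξ I t ω) := by
  have hpos := sum_weight_mul_ϑ_pos hA hS hω
  refine ⟨?_⟩
  unfold instrumental
  simp only [Measure.smul_apply, Measure.coe_finsetSum, Finset.sum_apply, measure_univ,
    smul_eq_mul, mul_one]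
  rw [← ENNReal.ofNNReal_finsetSum]
  exact ENNReal.inv_mul_cancel (by exact_mod_cast hpos.ne') ENNReal.coe_ne_top

/-- The importance weight cancels both the multiplier and the proposal density, leaving `m g`; the
multipliers survive only in the normalization, which drops out of ratios. -/
theorem integral_instrumental (hA : A.BoundedWith y W Θ) (hS : S.MixingWith y a b c G) (t : ℕ)
    (ω : Ω) {F : X → ℝ} (hF : BddMeas F) :
    ∫ z, (A.weightFn y (t + 1) (ξ t z.1 ω) z.2).toReal * F z.2 ∂(A.instrumental y ξ I t ω)
      = (∑ i, (A.weight y ξ I t i ω : ℝ) * A.ϑ (t + 1) (ξ t i ω))⁻¹ *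
        ∑ i, (A.weight y ξ I t i ω : ℝ) * ∫ x', S.lik y (t + 1) x' * F x' ∂(S.M (ξ t i ω)) := by
  have hB : BddMeas (fun z : Fin N × X =>
      (A.weightFn y (t + 1) (ξ t z.1 ω) z.2).toReal * F z.2) := by
    refine BddMeas.mul (BddMeas.of_mem_Icc ?_ fun z => hA.weightFn_toReal_mem t _ _)
      (hF.comp measurable_snd)
    refine (measurable_from_prod_countable_right fun i => ?_).ennreal_toReal
    exact (measurable_weightFn (t + 1)).comp (by fun_prop : Measurable fun x => (ξ t i ω, x))
  unfold instrumental
  rw [integral_smul_measure, integral_finsetSum_measure]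
  · rw [smul_eq_mul]
    congr 1
    · rw [← ENNReal.ofNNReal_finsetSum, ENNReal.toReal_inv, ENNReal.coe_toReal]
      push_cast
      rfl
    · refine Finset.sum_congr rfl fun i _ => ?_
      rw [integral_smul_measure, Measure.dirac_prod, integral_map (by fun_prop)
        hB.1.aestronglyMeasurable, ← hA.integral_P hS]
      simp [mul_assoc]
  · exact fun i _ => (hB.integrable _).smul_measure ENNReal.coe_ne_top

end Particles

end FilterDesign

end

/-! ### Deviation bounds for the hybrid estimates -/

noncomputable section

variable {X Y : Type*} [MeasurableSpace X] [MeasurableSpace Y] {N : ℕ}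

/-- The smoothing estimate of `h(X_s)` which uses the weighted samples of the flow `η` up to time
`t`, and the exact model dynamics from time `t` to time `T`. -/
def StateSpaceModel.sampleSmoother (S : StateSpaceModel X Y) (y : ℕ → Y) (T s : ℕ) (h : X → ℝ)
    (η : ℕ → Fin N → X × ℝ≥0) (t : ℕ) : ℝ :=
  (∑ i, ((η t i).2 : ℝ) * (S.lookahead (S.lik y) t (T - t) (η t i).1 *
      S.condSmoother y T s h η t (η t i).1)) /
    ∑ i, ((η t i).2 : ℝ) * S.lookahead (S.lik y) t (T - t) (η t i).1

theorem StateSpaceModel.sampleSmoother_congr (S : StateSpaceModel X Y) (y : ℕ → Y) (T s : ℕ)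
    (h : X → ℝ) {η η' : ℕ → Fin N → X × ℝ≥0} {t : ℕ} (hη : ∀ u, u ≤ t → η u = η' u) :
    S.sampleSmoother y T s h η t = S.sampleSmoother y T s h η' t := by
  unfold sampleSmoother
  rw [S.condSmoother_congr y T s h (t := t) fun u hu => hη u hu.le, hη t le_rfl]

theorem StateSpaceModel.MixingWith.measurable_sampleSmoother {S : StateSpaceModel X Y} {y : ℕ → Y}
    {a b c G : ℝ} (hS : S.MixingWith y a b c G) {T s : ℕ} {h : X → ℝ} (hh : BddMeas h) (t : ℕ) :
    Measurable (fun η : ℕ → Fin N → X × ℝ≥0 => S.sampleSmoother y T s h η t) := by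
  unfold sampleSmoother
  have hw : ∀ i : Fin N, Measurable fun η : ℕ → Fin N → X × ℝ≥0 => ((η t i).2 : ℝ) := fun i =>
    (by fun_prop : Measurable fun η : ℕ → Fin N → X × ℝ≥0 => (η t i).2).coe_nnreal_real
  have hx : ∀ i : Fin N, Measurable fun η : ℕ → Fin N → X × ℝ≥0 => (η t i).1 := fun i => by
    fun_prop
  have hβ : ∀ i : Fin N, Measurable fun η : ℕ → Fin N → X × ℝ≥0 =>
      S.lookahead (S.lik y) t (T - t) (η t i).1 := fun i =>
    (hS.bddMeas_lookahead_lik t (T - t)).1.comp (hx i)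
  refine Measurable.div (Finset.measurable_sum _ fun i _ => (hw i).mul ((hβ i).mul ?_))
    (Finset.measurable_sum _ fun i _ => (hw i).mul (hβ i))
  exact (hS.measurable_condSmoother hh t).comp (measurable_id.prodMk (hx i))

variable {S : StateSpaceModel X Y}

namespace FilterDesign

section Particles

variable {Ω : Type*}

/-- The flow of weighted samples of a particle filter. -/
def flow (A : FilterDesign S) (y : ℕ → Y) (ξ : ℕ → Fin N → Ω → X) (I : ℕ → Fin N → Ω → Fin N)
    (ω : Ω) (t : ℕ) (i : Fin N) : X × ℝ≥0 :=
  (ξ t i ω, A.weight y ξ I t i ω)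

variable {A : FilterDesign S} {y : ℕ → Y} {W Θ a b c G : ℝ}
  {ξ : ℕ → Fin N → Ω → X} {I : ℕ → Fin N → Ω → Fin N}

/-- Freezing the flow at time `t` makes the whole sequence measurable for the history, while the
congruence lemmas show that the hybrid estimate at `t` and the conditional smoother at `t + 1` are
unaffected. -/
theorem measurable_stopped_flow (t : ℕ) :
    Measurable[A.history y ξ I t] (fun ω u => A.flow y ξ I ω (min u t)) := by
  refine @measurable_pi_lambda _ _ _ (A.history y ξ I t) _ _ fun u => ?_
  refine @measurable_pi_lambda _ _ _ (A.history y ξ I t) _ _ fun i => ?_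
  have hle : MeasurableSpace.comap
      (fun ω => (ξ (min u t) i ω, A.weight y ξ I (min u t) i ω)) inferInstance
      ≤ A.history y ξ I t :=
    le_iSup_of_le (min u t) (le_iSup_of_le (min_le_right u t) (le_iSup_of_le i le_rfl))
  exact (comap_measurable _).mono hle le_rfl

variable [MeasurableSpace Ω] {μ : Measure Ω}

/-- Conditional application of `measure_pi_ratio_le` to the pairs (index, particle). The constant is
`d ^ 2 / (8 * K ^ 2)` with weight bound `K = W * (b / a)` and lower bound `d = c / (b / a * Θ)` on
the mean weight. -/
theorem measure_sampleSmoother_succ_le [IsProbabilityMeasure μ]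
    (hA : A.BoundedWith y W Θ) (hS : S.MixingWith y a b c G)
    (hF : A.IsParticleFilter y μ ξ I) {T s t : ℕ} (hsT : s ≤ T) (htT : t < T) {h : X → ℝ}
    (hh : Measurable h) {lo o κ δ : ℝ} (ho : 0 ≤ o) (hho : ∀ x, h x ∈ Set.Icc lo (lo + o))
    (hκ : 1 - a / b ≤ κ) (hδ : 0 < δ) :
    μ {ω | δ ≤ |S.sampleSmoother y T s h (A.flow y ξ I ω) (t + 1) -
        S.sampleSmoother y T s h (A.flow y ξ I ω) t|}
      ≤ ENNReal.ofReal (hoeffdingBound 2 ((c / (b / a * Θ)) ^ 2 / (8 * (W * (b / a)) ^ 2)) N δ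
          (κ ^ gap s (t + 1) * o)) := by
  obtain ⟨x₀⟩ : Nonempty X := S.χ.nonempty_of_neZero
  have hBh : BddMeas h := BddMeas.of_mem_Icc hh hho
  have hab : 0 < b / a := div_pos hS.b_pos hS.a_pos
  have hΘ : 0 < Θ := one_pos.trans_le hA.one_le
  set β : X → ℝ := S.lookahead (S.lik y) (t + 1) (T - (t + 1)) with hβ
  have hβB : BddMeas β := hS.bddMeas_lookahead_lik _ _
  have hβ0 : ∀ x, 0 < β x := hS.lookahead_pos _ _
  have hβlook : ∀ x, S.lookahead (S.lik y) t (T - t) x = ∫ x', S.lik y (t + 1) x' * β x' ∂(S.M x) :=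
    fun x => by
      rw [show T - t = (T - (t + 1)) + 1 by omega]
      rfl
  let H := ℕ → Fin N → X × ℝ≥0
  let wf : H × (Fin N × X) → ℝ := fun p => (A.weightFn y (t + 1) (p.1 t p.2.1).1 p.2.2).toReal
  -- Division by `β x₀` does not change the ratio, but it makes the weights bounded independently of
  -- the horizon.
  let u : H × (Fin N × X) → ℝ := fun p => wf p * (β p.2.2 / β x₀)
  let ψ : H × (Fin N × X) → ℝ := fun p => S.condSmoother y T s h p.1 (t + 1) p.2.2
  have hu : Measurable u := by
    have h1 : Measurable fun q : H × Fin N => (q.1 t q.2).1 :=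
      measurable_from_prod_countable_left fun j =>
        measurable_fst.comp ((measurable_pi_apply j).comp (measurable_pi_apply t))
    have h2 : Measurable fun p : H × (Fin N × X) => ((p.1 t p.2.1).1, p.2.2) :=
      (h1.comp (by fun_prop : Measurable fun p : H × (Fin N × X) => (p.1, p.2.1))).prodMk
        (by fun_prop)
    exact ((measurable_weightFn (t + 1)).comp h2).ennreal_toReal.mul
      ((hβB.1.comp (by fun_prop : Measurable fun p : H × (Fin N × X) => p.2.2)).div_const _)
  have hψ : Measurable ψ := (hS.measurable_condSmoother hBh (t + 1)).comp
    (by fun_prop : Measurable fun p : H × (Fin N × X) => (p.1, p.2.2))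
  have hpr : ∀ i : Fin N, Measurable fun p : H × (Fin N → Fin N × X) => (p.1, p.2 i) := fun i => by
    fun_prop
  let bad : Set (H × (Fin N → Fin N × X)) := {p | 0 < ∑ i, u (p.1, p.2 i) ∧
    δ ≤ |(∑ i, u (p.1, p.2 i) * ψ (p.1, p.2 i)) / (∑ i, u (p.1, p.2 i)) -
      S.sampleSmoother y T s h p.1 t|}
  have hbad : MeasurableSet bad := by
    have m1 : Measurable fun p : H × (Fin N → Fin N × X) => ∑ i, u (p.1, p.2 i) :=
      Finset.measurable_sum _ fun i _ => hu.comp (hpr i)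
    have m2 : Measurable fun p : H × (Fin N → Fin N × X) =>
        ∑ i, u (p.1, p.2 i) * ψ (p.1, p.2 i) :=
      Finset.measurable_sum _ fun i _ => (hu.comp (hpr i)).mul (hψ.comp (hpr i))
    have m3 : Measurable fun p : H × (Fin N → Fin N × X) => S.sampleSmoother y T s h p.1 t :=
      (hS.measurable_sampleSmoother hBh t).comp measurable_fst
    exact (measurableSet_lt measurable_const m1).inter
      (measurableSet_le measurable_const ((m2.div m1).sub m3).abs)
  have hpos : ∀ᵐ ω ∂μ, ∀ u, 0 < ∑ i, A.weight y ξ I u i ω := ae_all_iff.2 hF.total_pos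
  have hZ : Measurable fun ω (i : Fin N) => (I (t + 1) i ω, ξ (t + 1) i ω) :=
    measurable_pi_lambda _ fun i => (hF.measurable_I _ i).prodMk (hF.measurable_ξ _ i)
  have main := (hF.step t).measure_le hZ (measurable_stopped_flow t) hbad
    (c := ENNReal.ofReal (hoeffdingBound 2 ((c / (b / a * Θ)) ^ 2 / (8 * (W * (b / a)) ^ 2)) N δ
          (κ ^ gap s (t + 1) * o))) ?_
  -- Almost surely the new weights have positive sum, so the deviation event lies in `bad`, where
  -- the ratio is the hybrid estimate at `t + 1`.
  · refine le_trans (measure_mono_ae ?_) main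
    filter_upwards [hpos] with ω hω hδω
    have hst : ∀ u, u ≤ t → A.flow y ξ I ω u = A.flow y ξ I ω (min u t) := fun u hu => by
      rw [min_eq_left hu]
    have hwf : ∀ i, u (fun u => A.flow y ξ I ω (min u t), (I (t + 1) i ω, ξ (t + 1) i ω))
        = (A.flow y ξ I ω (t + 1) i).2 * β (A.flow y ξ I ω (t + 1) i).1 / β x₀ := by
      intro i
      simp only [u, wf, flow, min_self, weight]
      rw [mul_div_assoc]
      rfl
    have hψf : ∀ i, ψ (fun u => A.flow y ξ I ω (min u t), (I (t + 1) i ω, ξ (t + 1) i ω))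
        = S.condSmoother y T s h (A.flow y ξ I ω) (t + 1) (A.flow y ξ I ω (t + 1) i).1 := by
      intro i
      simp only [ψ, flow]
      rw [S.condSmoother_congr y T s h (t := t + 1)
        (η' := A.flow y ξ I ω) fun u hu => (hst u (by omega)).symm]
    have hsum : 0 < ∑ i, ((A.flow y ξ I ω (t + 1) i).2 : ℝ) * β (A.flow y ξ I ω (t + 1) i).1 := by
      obtain ⟨i, -, hi⟩ := Finset.exists_ne_zero_of_sum_ne_zero (hω (t + 1)).ne'
      refine Finset.sum_pos' (fun j _ => mul_nonneg (NNReal.coe_nonneg _) (hβ0 _).le)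
        ⟨i, Finset.mem_univ _, mul_pos ?_ (hβ0 _)⟩
      exact_mod_cast pos_iff_ne_zero.2 hi
    change _ ∧ _
    simp only [hwf, hψf]
    rw [← Finset.sum_div]
    refine ⟨div_pos hsum (hβ0 x₀), ?_⟩
    have e1 : (∑ i, (A.flow y ξ I ω (t + 1) i).2 * β (A.flow y ξ I ω (t + 1) i).1 / β x₀ *
        S.condSmoother y T s h (A.flow y ξ I ω) (t + 1) (A.flow y ξ I ω (t + 1) i).1) /
        ((∑ i, (A.flow y ξ I ω (t + 1) i).2 * β (A.flow y ξ I ω (t + 1) i).1) / β x₀)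
        = S.sampleSmoother y T s h (A.flow y ξ I ω) (t + 1) := by
      unfold StateSpaceModel.sampleSmoother
      simp only [div_mul_eq_mul_div, ← Finset.sum_div]
      rw [div_div_div_cancel_right₀ (hβ0 x₀).ne']
      simp only [mul_assoc, hβ]
    rw [e1, S.sampleSmoother_congr y T s h (t := t)
      (η' := A.flow y ξ I ω) fun u hu => (hst u hu).symm]
    exact hδω
  · filter_upwards [hpos] with ω hω
    have hprob := isProbabilityMeasure_instrumental hA hS (hω t)
    set η : H := fun u => A.flow y ξ I ω (min u t) with hη
    have hηt : η t = A.flow y ξ I ω t := by simp [hη]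
    have hmk : Measurable fun z : Fin N × X => (η, z) := measurable_prodMk_left
    obtain ⟨l, hl⟩ := hS.exists_Icc_condSmoother (T := T) (s := s) hh ho hho hκ hsT (η := η)
      (t + 1) fun u _ => hω (min u t)
    have hψB : BddMeas (S.condSmoother y T s h η (t + 1)) :=
      BddMeas.of_mem_Icc ((hS.measurable_condSmoother hBh (t + 1)).comp
        (measurable_prodMk_left (x := η))) hl
    have hlow : ∀ x, β x₀ / (b / a) ≤ β x := fun x => by
      rw [div_le_iff₀' hab]; exact hS.lookahead_harnack _ _ _ _
    set V := ∑ i, (A.weight y ξ I t i ω : ℝ) * A.ϑ (t + 1) (ξ t i ω) with hV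
    have hVpos : 0 < V := by
      have := sum_weight_mul_ϑ_pos hA hS (hω t)
      rw [hV]
      exact_mod_cast this
    have hInt : ∀ {F : X → ℝ}, BddMeas F →
        ∫ z, wf (η, z) * F z.2 ∂(A.instrumental y ξ I t ω) =
        V⁻¹ * ∑ i, (A.weight y ξ I t i ω : ℝ) *
          ∫ x', S.lik y (t + 1) x' * F x' ∂(S.M (ξ t i ω)) := by
      intro F hFB
      rw [← integral_instrumental hA hS t ω hFB]
      simp only [wf, hηt, flow]
    have hIu : ∫ z, u (η, z) ∂(A.instrumental y ξ I t ω) =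
        V⁻¹ * (∑ i, (A.weight y ξ I t i ω : ℝ) *
          S.lookahead (S.lik y) t (T - t) (ξ t i ω)) / β x₀ := by
      have : ∀ z, u (η, z) = wf (η, z) * β z.2 / β x₀ := fun z => by
        simp only [u]; ring
      simp only [this, integral_div, hInt hβB, hβlook]
    have hIuψ : ∫ z, u (η, z) * ψ (η, z) ∂(A.instrumental y ξ I t ω) =
        V⁻¹ * (∑ i, ((η t i).2 : ℝ) * (S.lookahead (S.lik y) t (T - t) (η t i).1 *
          S.condSmoother y T s h η t (η t i).1)) / β x₀ := by
      have : ∀ z, u (η, z) * ψ (η, z) =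
          wf (η, z) * (β z.2 * S.condSmoother y T s h η (t + 1) z.2) / β x₀ := fun z => by
        simp only [u, ψ]; ring
      simp only [this, integral_div, hInt (hβB.mul hψB)]
      rw [← hS.sum_integral_condSmoother hψB (by rw [hηt]; exact hω t) hsT htT]
      simp only [hηt, flow, hβ]
    have hden : 0 < ∑ i, (A.weight y ξ I t i ω : ℝ) *
        S.lookahead (S.lik y) t (T - t) (ξ t i ω) := by
      obtain ⟨i, -, hi⟩ := Finset.exists_ne_zero_of_sum_ne_zero (hω t).ne'
      refine Finset.sum_pos' (fun j _ => mul_nonneg (NNReal.coe_nonneg _)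
        (hS.lookahead_pos _ _ _).le) ⟨i, Finset.mem_univ _, mul_pos ?_ (hS.lookahead_pos _ _ _)⟩
      exact_mod_cast pos_iff_ne_zero.2 hi
    refine measure_pi_ratio_le (A.instrumental y ξ I t ω) N (u := fun z => u (η, z))
      (ψ := fun z => ψ (η, z)) (K := W * (b / a)) (lo := l)
      (R := S.sampleSmoother y T s h η t) (hu.comp hmk) (hψ.comp hmk)
      (div_pos hS.c_pos (mul_pos hab hΘ))
      (fun z => ?_) ?_ (fun z => hl z.2) ?_ hδ
    · have h1 := hA.weightFn_toReal_mem t (η t z.1).1 z.2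
      have h2 : β z.2 / β x₀ ≤ b / a := by
        rw [div_le_iff₀ (hβ0 x₀)]; exact hS.lookahead_harnack _ _ _ _
      exact ⟨mul_nonneg h1.1 (div_nonneg (hβ0 _).le (hβ0 _).le),
        mul_le_mul h1.2 h2 (div_nonneg (hβ0 _).le (hβ0 _).le) hA.W_pos.le⟩
    -- The mean of `u` is at least `d`: `h1` bounds its numerator below through Harnack and one step
    -- of likelihood, `h2` bounds the normalization `V` by `Θ ∑ ω`.
    · rw [hIu]
      have h1 : (∑ i, (A.weight y ξ I t i ω : ℝ)) * (c * (β x₀ / (b / a))) ≤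
          ∑ i, (A.weight y ξ I t i ω : ℝ) * S.lookahead (S.lik y) t (T - t) (ξ t i ω) := by
        rw [Finset.sum_mul]
        refine Finset.sum_le_sum fun i _ => mul_le_mul_of_nonneg_left ?_ (NNReal.coe_nonneg _)
        rw [show T - t = (T - (t + 1)) + 1 by omega]
        exact hS.le_lookahead_succ (div_pos (hβ0 _) hab).le hlow _
      have h2 : V ≤ (∑ i, (A.weight y ξ I t i ω : ℝ)) * Θ := by
        rw [hV, Finset.sum_mul]
        exact Finset.sum_le_sum fun i _ =>
          mul_le_mul_of_nonneg_left (hA.ϑ_le t _) (NNReal.coe_nonneg _)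
      rw [← div_eq_inv_mul, div_div, le_div_iff₀ (mul_pos hVpos (hβ0 _))]
      refine le_trans ?_ h1
      calc c / (b / a * Θ) * (V * β x₀)
          ≤ c / (b / a * Θ) * ((∑ i, (A.weight y ξ I t i ω : ℝ)) * Θ * β x₀) := by
            have := hS.c_pos
            have := (hβ0 x₀).le
            gcongr
        _ = _ := by
          have := hS.a_pos.ne'
          have := hS.b_pos.ne'
          field_simp
    -- The factors `V⁻¹` and `1 / β x₀` cancel, so the target of the ratio is exactly the hybrid
    -- estimate at time `t`.
    · rw [hIu, hIuψ, StateSpaceModel.sampleSmoother]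
      have e : ∑ i, ((η t i).2 : ℝ) * S.lookahead (S.lik y) t (T - t) (η t i).1
          = ∑ i, (A.weight y ξ I t i ω : ℝ) * S.lookahead (S.lik y) t (T - t) (ξ t i ω) := by
        simp only [hηt, flow]
      rw [e]
      field_simp

/-- The unconditional analogue for the initial sample: its target is the exact smoothing law,
because `weightFn₀` turns `ρ₀` into `χ` reweighted by the first likelihood. -/
theorem measure_sampleSmoother_zero_le (hA : A.BoundedWith y W Θ) (hS : S.MixingWith y a b c G)
    (hF : A.IsParticleFilter y μ ξ I) {T : ℕ} (s : Fin (T + 1)) {h : X → ℝ}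
    (hh : Measurable h) {lo o κ δ : ℝ} (ho : 0 ≤ o) (hho : ∀ x, h x ∈ Set.Icc lo (lo + o))
    (hκ : 1 - a / b ≤ κ) (hδ : 0 < δ) :
    μ {ω | δ ≤ |S.sampleSmoother y T s h (A.flow y ξ I ω) 0 - S.smoothing y T s h|}
      ≤ ENNReal.ofReal (hoeffdingBound 2 ((c / (b / a * Θ)) ^ 2 / (8 * (W * (b / a)) ^ 2)) N δ
          (κ ^ gap s 0 * o)) := by
  obtain ⟨x₀⟩ : Nonempty X := S.χ.nonempty_of_neZero
  have hsT : (s : ℕ) ≤ T := by omega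
  have hBh : BddMeas h := BddMeas.of_mem_Icc hh hho
  have hab : 0 < b / a := div_pos hS.b_pos hS.a_pos
  have hΘ : 0 < Θ := one_pos.trans_le hA.one_le
  set β : X → ℝ := S.lookahead (S.lik y) 0 T with hβ
  have hβB : BddMeas β := hS.bddMeas_lookahead_lik _ _
  have hβ0 : ∀ x, 0 < β x := hS.lookahead_pos _ _
  -- At time `0` no earlier sample is used, so the flow is a dummy and its zero weights are
  -- harmless.
  let ψ : X → ℝ := S.condSmoother y T s h (fun _ _ => (x₀, 0) : ℕ → Fin N → X × ℝ≥0) 0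
  have hψflow : ∀ η : ℕ → Fin N → X × ℝ≥0, S.condSmoother y T s h η 0 = ψ := fun η =>
    S.condSmoother_congr y T s h fun u hu => absurd hu (Nat.not_lt_zero u)
  obtain ⟨l, hl⟩ := hS.exists_Icc_condSmoother (T := T) (s := s) hh ho hho hκ hsT
    (η := (fun _ _ => (x₀, 0) : ℕ → Fin N → X × ℝ≥0)) 0
    fun u hu => absurd hu (Nat.not_lt_zero u)
  have hψ : Measurable ψ := (hS.measurable_condSmoother hBh 0).comp measurable_prodMk_left
  let u : X → ℝ := fun x => (A.weightFn₀ y x).toReal * (β x / β x₀)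
  have hu : Measurable u := measurable_weightFn₀.ennreal_toReal.mul (hβB.1.div_const _)
  have hIu : ∫ x, u x ∂A.ρ₀ = (∫ x, S.lik y 0 x * β x ∂S.χ) / β x₀ := by
    have : ∀ x, u x = (A.weightFn₀ y x).toReal * β x / β x₀ := fun x => by
      simp only [u]; ring
    simp only [this, integral_div]
    rw [BoundedWith.integral_ρ₀]
  have hIuψ : ∫ x, u x * ψ x ∂A.ρ₀ = (∫ x, S.lik y 0 x * (β x * ψ x) ∂S.χ) / β x₀ := by
    have : ∀ x, u x * ψ x = (A.weightFn₀ y x).toReal * (β x * ψ x) / β x₀ := fun x => by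
      simp only [u]; ring
    simp only [this, integral_div]
    rw [BoundedWith.integral_ρ₀]
  have hnum : ∀ x, S.likAt y s h 0 x * S.lookahead (S.likAt y s h) 0 T x
      = S.lik y 0 x * (β x * ψ x) := by
    intro x
    rcases Nat.eq_zero_or_pos (s : ℕ) with h0 | h0
    · have e1 : ψ x = h x := by
        simp only [ψ]
        conv_lhs => rw [h0]
        rw [S.condSmoother_self]
      rw [e1, StateSpaceModel.likAt, if_pos h0.symm,
        S.lookahead_congr (f' := S.lik y) 0 T fun u hu => ?_]
      · ring
      · ext z
        rw [StateSpaceModel.likAt, if_neg (by omega)]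
    · rw [StateSpaceModel.likAt, if_neg h0.ne]
      simp only [ψ, StateSpaceModel.condSmoother, if_pos h0, Nat.sub_zero]
      rw [mul_div_cancel₀ _ (hβ0 x).ne']
  have hlow : ∀ x, β x₀ / (b / a) ≤ β x := fun x => by
    rw [div_le_iff₀' hab]; exact hS.lookahead_harnack _ _ _ _
  have hden := hS.le_integral_init (div_pos (hβ0 x₀) hab).le hlow
  have hdenpos : 0 < ∫ x, S.lik y 0 x * β x ∂S.χ :=
    (mul_pos hS.c_pos (div_pos (hβ0 x₀) hab)).trans_le hden
  have main := measure_pi_ratio_le A.ρ₀ N (u := u) (ψ := ψ) (K := W * (b / a))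
    (d := c / (b / a * Θ)) (R := S.smoothing y T s h) (δ := δ) hu hψ
    (div_pos hS.c_pos (mul_pos hab hΘ)) (fun x => ?_) ?_ hl ?_ hδ
  · rw [← hF.init] at main
    refine le_trans (measure_mono_ae ?_)
      ((Measure.le_map_apply
        (measurable_pi_lambda _ fun i => hF.measurable_ξ 0 i).aemeasurable _).trans main)
    filter_upwards [hF.total_pos 0] with ω hω hδω
    have hwf : ∀ i, u (ξ 0 i ω) = (A.flow y ξ I ω 0 i).2 * β (A.flow y ξ I ω 0 i).1 / β x₀ := by
      intro i
      simp only [u, flow, weight]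
      rw [mul_div_assoc]
      rfl
    have hsum : 0 < ∑ i, ((A.flow y ξ I ω 0 i).2 : ℝ) * β (A.flow y ξ I ω 0 i).1 := by
      obtain ⟨i, -, hi⟩ := Finset.exists_ne_zero_of_sum_ne_zero hω.ne'
      refine Finset.sum_pos' (fun j _ => mul_nonneg (NNReal.coe_nonneg _) (hβ0 _).le)
        ⟨i, Finset.mem_univ _, mul_pos ?_ (hβ0 _)⟩
      exact_mod_cast pos_iff_ne_zero.2 hi
    change _ ∧ _
    simp only [hwf]
    rw [← Finset.sum_div]
    refine ⟨div_pos hsum (hβ0 x₀), ?_⟩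
    have e1 : (∑ i, (A.flow y ξ I ω 0 i).2 * β (A.flow y ξ I ω 0 i).1 / β x₀ * ψ (ξ 0 i ω)) /
        ((∑ i, (A.flow y ξ I ω 0 i).2 * β (A.flow y ξ I ω 0 i).1) / β x₀)
        = S.sampleSmoother y T s h (A.flow y ξ I ω) 0 := by
      unfold StateSpaceModel.sampleSmoother
      simp only [div_mul_eq_mul_div, ← Finset.sum_div, hψflow]
      rw [div_div_div_cancel_right₀ (hβ0 x₀).ne']
      simp only [mul_assoc, hβ, flow, Nat.sub_zero]
    rw [e1]
    exact hδω
  · have h1 := hA.weightFn₀_toReal_mem x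
    have h2 : β x / β x₀ ≤ b / a := by
      rw [div_le_iff₀ (hβ0 x₀)]; exact hS.lookahead_harnack _ _ _ _
    exact ⟨mul_nonneg h1.1 (div_nonneg (hβ0 _).le (hβ0 _).le),
      mul_le_mul h1.2 h2 (div_nonneg (hβ0 _).le (hβ0 _).le) hA.W_pos.le⟩
  · rw [hIu, le_div_iff₀ (hβ0 x₀)]
    refine le_trans ?_ hden
    have h3 : c / (b / a * Θ) ≤ c / (b / a) :=
      div_le_div_of_nonneg_left hS.c_pos.le hab (le_mul_of_one_le_right hab.le hA.one_le)
    calc c / (b / a * Θ) * β x₀ ≤ c / (b / a) * β x₀ :=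
          mul_le_mul_of_nonneg_right h3 (hβ0 x₀).le
      _ = _ := by ring
  · rw [hIu, hIuψ, S.smoothing_eq hS.bddMeas_lik hBh]
    simp only [hnum]
    rw [← hβ]
    field_simp

end Particles

end FilterDesign

end

noncomputable section

/-! ### Summing the deviation bounds -/

/-- Each distance from `s` occurs at most twice, once on each side. -/
theorem sum_gap_le {f : ℕ → ℝ} {K : ℝ} (hf : ∀ k, 0 ≤ f k)
    (hK : ∀ n, ∑ k ∈ Finset.range n, f k ≤ K) {s T : ℕ} (hsT : s ≤ T) :
    ∑ t ∈ Finset.range (T + 1), f (gap s t) ≤ 2 * K := by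
  obtain ⟨m, hm⟩ := Nat.exists_eq_add_of_le (show s ≤ T + 1 by omega)
  rw [hm, Finset.sum_range_add, two_mul]
  refine add_le_add ?_ ?_
  · have h1 : ∑ t ∈ Finset.range s, f (gap s t) = ∑ t ∈ Finset.range s, f (t + 1) := by
      rw [← Finset.sum_range_reflect]
      refine Finset.sum_congr rfl fun t ht => ?_
      have := Finset.mem_range.1 ht
      rw [show gap s (s - 1 - t) = t + 1 by unfold gap; omega]
    have h2 := hK (s + 1)
    rw [Finset.sum_range_succ'] at h2
    rw [h1]
    linarith [hf 0]
  · refine le_trans (le_of_eq (Finset.sum_congr rfl fun t _ => ?_)) (hK m)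
    rw [show gap s (s + t) = t by unfold gap; omega]

theorem geom_sum_range_le {r : ℝ} (h0 : 0 ≤ r) (h1 : r < 1) (n : ℕ) :
    ∑ k ∈ Finset.range n, r ^ k ≤ (1 - r)⁻¹ := by
  rw [← tsum_geometric_of_lt_one h0 h1]
  exact (summable_geometric_of_lt_one h0 h1).sum_le_tsum _ fun k _ => by positivity

theorem hoeffdingBound_nonneg {B C : ℝ} (hB : 0 ≤ B) (N : ℕ) (ε o : ℝ) :
    0 ≤ hoeffdingBound B C N ε o := by
  unfold hoeffdingBound
  split_ifs <;> positivity

theorem hoeffdingBound_mono {B B' C C' : ℝ} (hB : 0 ≤ B) (hBB : B ≤ B') (hC : C' ≤ C) (N : ℕ)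
    (ε o : ℝ) : hoeffdingBound B C N ε o ≤ hoeffdingBound B' C' N ε o := by
  unfold hoeffdingBound
  split_ifs
  · exact le_rfl
  · have := hB.trans hBB
    gcongr

/-- At distance `e` from `s` the exponent is `z * θ⁻²ᵉ`, which Bernoulli bounds below by `z + e * z
* lam`. The terms are thus dominated by `2 * exp (-z) * q ^ e` with `q = exp (-z * lam)`. -/
theorem exists_sum_hoeffdingBound_le {θ C₀ : ℝ} (hθ : 0 < θ) (hθ1 : θ < 1) (hC₀ : 0 < C₀) :
    ∃ B C : ℝ, 0 < B ∧ 0 < C ∧ ∀ (N T s : ℕ), s ≤ T → ∀ (ε o p : ℝ), 0 ≤ o → p ≤ 1 →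
      p ≤ ∑ t ∈ Finset.range (T + 1),
        hoeffdingBound 2 C₀ N (ε * ((1 - θ) / 2 * θ ^ gap s t)) ((θ ^ 2) ^ gap s t * o) →
      p ≤ hoeffdingBound B C N ε o := by
  set lam := (θ ^ 2)⁻¹ - 1 with hlam
  have hθ2 : θ ^ 2 < 1 := pow_lt_one₀ hθ.le hθ1 two_ne_zero
  have hlam0 : 0 < lam := sub_pos.2 ((one_lt_inv₀ (by positivity)).2 hθ2)
  have h1θ : 0 < 1 - θ := sub_pos.2 hθ1
  refine ⟨8 + Real.exp (Real.log 2 / lam), C₀ * ((1 - θ) / 2) ^ 2, by positivity, by positivity,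
    fun N T s hsT ε o p ho hp1 hp => ?_⟩
  rcases eq_or_lt_of_le ho with ho0 | ho0
  · subst ho0
    simpa [hoeffdingBound] using hp
  set z := C₀ * ((1 - θ) / 2) ^ 2 * N * ε ^ 2 / o ^ 2 with hz
  have hz0 : 0 ≤ z := by positivity
  rw [hoeffdingBound, if_neg ho0.ne', ← hz]
  set q := Real.exp (-(z * lam)) with hq
  have hterm : ∀ e : ℕ, hoeffdingBound 2 C₀ N (ε * ((1 - θ) / 2 * θ ^ e)) ((θ ^ 2) ^ e * o)
      ≤ 2 * Real.exp (-z) * q ^ e := by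
    intro e
    have hne : (θ ^ 2) ^ e * o ≠ 0 := by positivity
    rw [hoeffdingBound, if_neg hne, mul_assoc 2, hq, ← Real.exp_nat_mul, ← Real.exp_add]
    gcongr
    have e1 : C₀ * N * (ε * ((1 - θ) / 2 * θ ^ e)) ^ 2 / ((θ ^ 2) ^ e * o) ^ 2
        = z * ((θ ^ 2)⁻¹) ^ e := by
      rw [hz, inv_pow]
      field_simp
      ring
    have e2 : 1 + (e : ℝ) * lam ≤ ((θ ^ 2)⁻¹) ^ e := by
      have := one_add_mul_le_pow (a := lam) (by linarith) e
      rwa [show 1 + lam = (θ ^ 2)⁻¹ by rw [hlam]; ring] at this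
    rw [e1]
    have := mul_le_mul_of_nonneg_left e2 hz0
    linarith
  -- For `q ≤ 1/2` the two-sided geometric sum is at most `8 * exp (-z)`. Otherwise `z < log 2 /
  -- lam`, and the second summand of `B` makes the bound exceed the trivial `p ≤ 1`.
  rcases le_or_gt q (1 / 2) with hq2 | hq2
  · have hq0 : 0 ≤ q := (Real.exp_pos _).le
    have hsum := sum_gap_le (f := fun e => 2 * Real.exp (-z) * q ^ e)
      (K := 2 * Real.exp (-z) * (1 - q)⁻¹) (fun k => by positivity) (fun n => by
        rw [← Finset.mul_sum]
        gcongr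
        exact geom_sum_range_le hq0 (by linarith) n) hsT
    have hinv : (1 - q)⁻¹ ≤ 2 := by
      rw [inv_le_comm₀ (by linarith) two_pos]
      linarith
    calc p ≤ _ := hp
      _ ≤ ∑ t ∈ Finset.range (T + 1), 2 * Real.exp (-z) * q ^ gap s t :=
        Finset.sum_le_sum fun t _ => hterm _
      _ ≤ 2 * (2 * Real.exp (-z) * (1 - q)⁻¹) := hsum
      _ ≤ 2 * (2 * Real.exp (-z) * 2) := by gcongr
      _ = 8 * Real.exp (-z) := by ring
      _ ≤ _ := by
        gcongr
        exact le_add_of_nonneg_right (Real.exp_pos _).le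
  · have h3 : z * lam < Real.log 2 := by
      have := Real.log_lt_log (by norm_num) hq2
      rw [hq, Real.log_exp, one_div, Real.log_inv] at this
      linarith
    have h4 : 0 ≤ Real.log 2 / lam + -z := by
      have := (lt_div_iff₀ hlam0).2 h3
      linarith
    calc p ≤ 1 := hp1
      _ ≤ Real.exp (Real.log 2 / lam) * Real.exp (-z) := by
        rw [← Real.exp_add]
        exact Real.one_le_exp h4
      _ ≤ _ := by
        gcongr
        linarith

/-! ### Backward index paths -/

theorem sum_snoc {α : Type*} [Fintype α] {n : ℕ} (F : (Fin (n + 1) → α) → ℝ) :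
    ∑ j, F j = ∑ i, ∑ j : Fin n → α, F (Fin.snoc (α := fun _ => α) j i) := by
  rw [← Fintype.sum_prod_type' (f := fun i (j : Fin n → α) => F (Fin.snoc (α := fun _ => α) j i))]
  exact (Fintype.sum_equiv (Fin.snocEquiv fun _ => α) _ _ fun _ => rfl).symm

/-- The backward iterates of a family of transition matrices. -/
def matrixBackward {α : Type*} [Fintype α] (Λ : ℕ → α → α → ℝ) (s : ℕ) (F : α → ℝ) : ℕ → α → ℝ
  | 0, i => F i
  | k + 1, i => ∑ j, Λ (s + k) i j * matrixBackward Λ s F k j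

/-- With the terminal index `i` fixed, the rest is a shorter path with terminal vector `v i * Λ n i
·`, of total mass `v i` by row-stochasticity. -/
theorem sum_path_mul_prod {α : Type*} [Fintype α] {Λ : ℕ → α → α → ℝ} {n : ℕ}
    (hΛ : ∀ t < n, ∀ i, ∑ j, Λ t i j = 1) (v : α → ℝ) :
    ∑ j : Fin (n + 1) → α, v (j (Fin.last n)) * ∏ t : Fin n, Λ t (j t.succ) (j t.castSucc)
      = ∑ i, v i := by
  induction n generalizing v with
  | zero =>
    rw [sum_snoc]
    simp [Fin.snoc]
  | succ n ih =>
    rw [sum_snoc]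
    refine Finset.sum_congr rfl fun i _ => ?_
    simp only [Fin.snoc_last, Fin.prod_univ_castSucc (n := n), Fin.val_last, Fin.succ_last,
      Fin.val_castSucc, Fin.snoc_castSucc, ← Fin.castSucc_succ]
    have h1 := ih (fun t ht => hΛ t (by omega)) (fun k => v i * Λ n i k)
    rw [← Finset.mul_sum, hΛ n (by omega), mul_one] at h1
    refine Eq.trans ?_ h1
    exact Finset.sum_congr rfl fun j _ => by ring

/-- The marginal of the backward chain: indices before `s` sum out to one, and the matrices from `s`
on act on `F`. The induction replaces `v` by its image under the last matrix. -/
theorem sum_path_mul_prod_mul {α : Type*} [Fintype α] {Λ : ℕ → α → α → ℝ} {n : ℕ}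
    (hΛ : ∀ t < n, ∀ i, ∑ j, Λ t i j = 1) (v F : α → ℝ) (s : Fin (n + 1)) :
    ∑ j : Fin (n + 1) → α, v (j (Fin.last n)) *
        (∏ t : Fin n, Λ t (j t.succ) (j t.castSucc)) * F (j s)
      = ∑ i, v i * matrixBackward Λ s F (n - s) i := by
  induction n generalizing v with
  | zero =>
    obtain rfl : s = Fin.last 0 := Fin.ext (by have := s.2; rw [Fin.val_last]; omega)
    rw [sum_snoc]
    simp [Fin.snoc, matrixBackward]
  | succ n ih =>
    refine Fin.lastCases ?_ (fun s => ?_) s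
    · have h1 := sum_path_mul_prod hΛ (fun i => v i * F i)
      simp only [Fin.val_last, Nat.sub_self, matrixBackward]
      rw [← h1]
      exact Finset.sum_congr rfl fun j _ => by ring
    · rw [sum_snoc]
      simp only [Fin.snoc_last, Fin.prod_univ_castSucc (n := n), Fin.val_last, Fin.succ_last,
        Fin.val_castSucc, Fin.snoc_castSucc, ← Fin.castSucc_succ]
      rw [show n + 1 - (s : ℕ) = (n - s) + 1 by omega]
      simp only [matrixBackward]
      rw [show (s : ℕ) + (n - s) = n by omega, Finset.sum_congr rfl fun i _ => Finset.mul_sum _ _ _]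
      have h1 := ih (fun t ht => hΛ t (by omega)) (fun k => ∑ i, v i * Λ n i k) s
      simp only [Finset.sum_mul] at h1
      rw [Finset.sum_comm] at h1
      refine Eq.trans ?_ (h1.trans ?_)
      · exact Finset.sum_congr rfl fun i _ => Finset.sum_congr rfl fun j _ => by ring
      · rw [Finset.sum_comm]
        exact Finset.sum_congr rfl fun i _ => Finset.sum_congr rfl fun j _ => by ring

end

/-! ### Identification of the two estimators, and the union bound -/

noncomputable section

variable {X Y : Type*} [MeasurableSpace X] [MeasurableSpace Y] {N : ℕ}
  {S : StateSpaceModel X Y}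

theorem StateSpaceModel.sampleSmoother_self (y : ℕ → Y) {T s : ℕ} (hsT : s ≤ T) (h : X → ℝ)
    (η : ℕ → Fin N → X × ℝ≥0) :
    S.sampleSmoother y T s h η T =
      (∑ i, ((η T i).2 : ℝ) * S.sampleBackward η s h (T - s) (η T i).1) /
        ∑ i, ((η T i).2 : ℝ) := by
  simp [sampleSmoother, condSmoother, lookahead, hsT.not_gt]

namespace FilterDesign

variable {Ω : Type*} {A : FilterDesign S} {y : ℕ → Y} {W Θ a b c G : ℝ}
  {ξ : ℕ → Fin N → Ω → X} {I : ℕ → Fin N → Ω → Fin N}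

/-- Measurable singletons allow Dirac integrals of arbitrary functions to be evaluated. -/
theorem integral_filterHat [MeasurableSingletonClass X] (ω : Ω) (t : ℕ) (f : X → ℝ) :
    ∫ x, f x ∂(A.filterHat y ξ I ω t) =
      (∑ i, f (ξ t i ω) * A.weight y ξ I t i ω) / ∑ i, (A.weight y ξ I t i ω : ℝ) := by
  unfold filterHat
  rw [integral_finsetSum_measure fun i _ =>
    (integrable_dirac (by simp)).smul_measure ENNReal.coe_ne_top, Finset.sum_div]
  refine Finset.sum_congr rfl fun i _ => ?_
  rw [integral_smul_measure, integral_dirac, ENNReal.coe_toReal, smul_eq_mul]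
  push_cast
  ring

theorem backwardIter_filterHat [MeasurableSingletonClass X] {ω : Ω}
    (hω : ∀ t, 0 < ∑ i, A.weight y ξ I t i ω) (s : ℕ) (h : X → ℝ) (n : ℕ) :
    S.backwardIter (A.filterHat y ξ I ω) s h n = S.sampleBackward (A.flow y ξ I ω) s h n := by
  induction n with
  | zero => rfl
  | succ n ih =>
    ext x
    have hpos : (∑ i, (A.weight y ξ I (s + n) i ω : ℝ)) ≠ 0 := by exact_mod_cast (hω (s + n)).ne'
    simp only [StateSpaceModel.backwardIter, StateSpaceModel.backwardKernel, integral_filterHat, ih,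
      StateSpaceModel.sampleBackward]
    rw [div_div_div_cancel_right₀ hpos]
    congr 1
    exact Finset.sum_congr rfl fun i _ => by simp only [flow]; ring

theorem ffbs_eq_sampleSmoother [MeasurableSingletonClass X] {ω : Ω}
    (hω : ∀ t, 0 < ∑ i, A.weight y ξ I t i ω) {T : ℕ} (s : Fin (T + 1)) (h : X → ℝ) :
    A.ffbs y ξ I T s h ω = S.sampleSmoother y T s h (A.flow y ξ I ω) T := by
  rw [ffbs, backwardIter_filterHat hω, integral_filterHat,
    StateSpaceModel.sampleSmoother_self y (by omega)]
  congr 1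
  exact Finset.sum_congr rfl fun i _ => by simp only [flow]; ring

theorem sum_weight_mul_m_pos (hS : S.MixingWith y a b c G) {ω : Ω} {t : ℕ}
    (hω : 0 < ∑ i, A.weight y ξ I t i ω) (x : X) :
    0 < ∑ l, A.weight y ξ I t l ω * S.m (ξ t l ω) x := by
  obtain ⟨i, -, hi⟩ := Finset.exists_ne_zero_of_sum_ne_zero hω.ne'
  exact Finset.sum_pos' (fun _ _ => zero_le)
    ⟨i, Finset.mem_univ _, mul_pos (pos_iff_ne_zero.2 hi) (by exact_mod_cast hS.m_pos _ _)⟩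

theorem sum_backwardMatrix (hS : S.MixingWith y a b c G) {ω : Ω} {t : ℕ}
    (hω : 0 < ∑ i, A.weight y ξ I t i ω) (i : Fin N) :
    ∑ j, (A.backwardMatrix y ξ I t ω i j : ℝ) = 1 := by
  unfold backwardMatrix
  have := (sum_weight_mul_m_pos hS hω (ξ (t + 1) i ω)).ne'
  rw [← NNReal.coe_sum, ← Finset.sum_div, div_self this, NNReal.coe_one]

theorem matrixBackward_backwardMatrix (ω : Ω) (s : ℕ) (h : X → ℝ) (n : ℕ) (i : Fin N) :
    matrixBackward (fun t i j => (A.backwardMatrix y ξ I t ω i j : ℝ)) s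
      (fun i => h (ξ s i ω)) n i =
      S.sampleBackward (A.flow y ξ I ω) s h n (ξ (s + n) i ω) := by
  induction n generalizing i with
  | zero => rfl
  | succ n ih =>
    simp only [matrixBackward, ih]
    simp only [StateSpaceModel.sampleBackward, backwardMatrix, flow]
    rw [Finset.sum_div]
    refine Finset.sum_congr rfl fun j _ => ?_
    push_cast
    simp only [mul_comm (S.m _ _ : ℝ)]
    rw [div_mul_eq_mul_div]
    rfl

theorem integral_indexPathLaw (T : ℕ) (ω : Ω) (F : (Fin (T + 1) → Fin N) → ℝ) :
    ∫ j, F j ∂(A.indexPathLaw y ξ I T ω) =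
      ∑ j : Fin (T + 1) → Fin N, (A.weight y ξ I T (j (Fin.last T)) ω : ℝ) /
        (∑ i, (A.weight y ξ I T i ω : ℝ)) *
        (∏ t : Fin T, (A.backwardMatrix y ξ I t ω (j t.succ) (j t.castSucc) : ℝ)) * F j := by
  unfold indexPathLaw
  rw [integral_finsetSum_measure fun i _ =>
    (integrable_dirac (by simp)).smul_measure ENNReal.coe_ne_top]
  refine Finset.sum_congr rfl fun j _ => ?_
  rw [integral_smul_measure, integral_dirac, ENNReal.coe_toReal, smul_eq_mul]
  push_cast
  rfl

theorem isProbabilityMeasure_indexPathLaw (hS : S.MixingWith y a b c G) {ω : Ω}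
    (hω : ∀ t, 0 < ∑ i, A.weight y ξ I t i ω) (T : ℕ) :
    IsProbabilityMeasure (A.indexPathLaw y ξ I T ω) := by
  have hfin : IsFiniteMeasure (A.indexPathLaw y ξ I T ω) := by
    refine ⟨?_⟩
    unfold indexPathLaw
    simp [Measure.coe_finsetSum, ENNReal.sum_lt_top, -ENNReal.coe_mul]
  have h1 := integral_indexPathLaw (A := A) (y := y) (ξ := ξ) (I := I) T ω fun _ => 1
  simp only [mul_one] at h1
  have hpos : (∑ i, (A.weight y ξ I T i ω : ℝ)) ≠ 0 := by exact_mod_cast (hω T).ne'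
  rw [sum_path_mul_prod (Λ := fun t i j => (A.backwardMatrix y ξ I t ω i j : ℝ))
    (fun t _ i => sum_backwardMatrix hS (hω t) i)
    (fun i => (A.weight y ξ I T i ω : ℝ) / ∑ i, (A.weight y ξ I T i ω : ℝ)), ← Finset.sum_div,
    div_self hpos] at h1
  rw [integral_const, smul_eq_mul, mul_one] at h1
  refine ⟨?_⟩
  rwa [Measure.real, ENNReal.toReal_eq_one_iff] at h1

/-- The time-`s` marginal of the index path is obtained by iterating the backward matrices, which
are the backward kernels restricted to the particles. Hence FFBS is the conditional mean of FFBSi.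
-/
theorem integral_indexPathLaw_apply (hS : S.MixingWith y a b c G) {ω : Ω}
    (hω : ∀ t, 0 < ∑ i, A.weight y ξ I t i ω) {T : ℕ} (s : Fin (T + 1)) (h : X → ℝ) :
    ∫ j, h (ξ s (j s) ω) ∂(A.indexPathLaw y ξ I T ω) =
      S.sampleSmoother y T s h (A.flow y ξ I ω) T := by
  have hsT : (s : ℕ) ≤ T := by omega
  rw [integral_indexPathLaw, sum_path_mul_prod_mul
    (Λ := fun t i j => (A.backwardMatrix y ξ I t ω i j : ℝ))
    (fun t _ i => sum_backwardMatrix hS (hω t) i)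
    (fun i => (A.weight y ξ I T i ω : ℝ) / ∑ i, (A.weight y ξ I T i ω : ℝ))
    (fun i => h (ξ s i ω)) s, StateSpaceModel.sampleSmoother_self y hsT, Finset.sum_div]
  refine Finset.sum_congr rfl fun i _ => ?_
  rw [matrixBackward_backwardMatrix, show (s : ℕ) + (T - s) = T by omega, div_mul_eq_mul_div]
  rfl

variable [MeasurableSpace Ω] {μ : Measure Ω} [IsProbabilityMeasure μ]

/-- Conditional Hoeffding inequality for the backward simulation step. -/
theorem measure_ffbsi_sub_sampleSmoother_le (hS : S.MixingWith y a b c G)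
    (hF : A.IsParticleFilter y μ ξ I) (hN : 1 ≤ N) {T : ℕ} (s : Fin (T + 1))
    {J : Fin N → Fin (T + 1) → Ω → Fin N} (hJ : A.IsBackwardSimulation y μ ξ I T J) {h : X → ℝ}
    (hh : Measurable h) {lo o δ : ℝ} (hho : ∀ x, h x ∈ Set.Icc lo (lo + o)) (hδ : 0 < δ) :
    μ {ω | δ ≤ |ffbsi ξ T J s h ω - S.sampleSmoother y T s h (A.flow y ξ I ω) T|}
      ≤ ENNReal.ofReal (hoeffdingBound 2 2 N δ o) := by
  have hBh : BddMeas h := BddMeas.of_mem_Icc hh hho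
  have hsT : (s : ℕ) ≤ T := by omega
  let H := ℕ → Fin N → X × ℝ≥0
  let bad : Set (H × (Fin N → Fin (T + 1) → Fin N)) :=
    {p | δ ≤ |(N : ℝ)⁻¹ * ∑ l, h (p.1 s (p.2 l s)).1 - S.sampleSmoother y T s h p.1 T|}
  have hbad : MeasurableSet bad := by
    have h1 : Measurable fun q : H × Fin N => (q.1 s q.2).1 :=
      measurable_from_prod_countable_left fun j =>
        measurable_fst.comp ((measurable_pi_apply j).comp (measurable_pi_apply (s : ℕ)))
    have h2 : ∀ l, Measurable fun p : H × (Fin N → Fin (T + 1) → Fin N) => (p.1, p.2 l s) :=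
      fun l => by fun_prop
    exact measurableSet_le measurable_const (((Finset.measurable_sum _ fun l _ =>
      hh.comp (h1.comp (h2 l))).const_mul _).sub
      ((hS.measurable_sampleSmoother hBh T).comp measurable_fst)).abs
  have hpos : ∀ᵐ ω ∂μ, ∀ u, 0 < ∑ i, A.weight y ξ I u i ω := ae_all_iff.2 hF.total_pos
  have hZ : Measurable fun ω (l : Fin N) (t : Fin (T + 1)) => J l t ω :=
    measurable_pi_lambda _ fun l => measurable_pi_lambda _ fun t => hJ.measurable_J l t
  have hst : ∀ ω u, u ≤ T → A.flow y ξ I ω u = A.flow y ξ I ω (min u T) := fun ω u hu => by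
    rw [min_eq_left hu]
  have hsm : ∀ ω, S.sampleSmoother y T s h (fun u => A.flow y ξ I ω (min u T)) T =
      S.sampleSmoother y T s h (A.flow y ξ I ω) T := fun ω =>
    S.sampleSmoother_congr y T s h fun u hu => (hst ω u hu).symm
  have main := hJ.condLaw.measure_le hZ (measurable_stopped_flow T) hbad
    (c := ENNReal.ofReal (hoeffdingBound 2 2 N δ o)) ?_
  · refine le_trans (measure_mono fun ω hω => ?_) main
    change δ ≤ |(N : ℝ)⁻¹ * ∑ l, h (A.flow y ξ I ω (min s T) (J l s ω)).1 - _|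
    rw [hsm, min_eq_left hsT]
    exact hω
  · filter_upwards [hpos] with ω hω
    have := isProbabilityMeasure_indexPathLaw hS hω T
    refine le_trans (measure_mono fun j hj => ?_) (measure_pi_abs_mean_sub_le
      (A.indexPathLaw y ξ I T ω) hN (Y := fun j => h (ξ s (j s) ω)) (measurable_of_finite _)
      (fun j => hho _) hδ)
    change δ ≤ |(N : ℝ)⁻¹ * ∑ l, h (A.flow y ξ I ω (min s T) (j l s)).1 - _| at hj
    rw [hsm, min_eq_left hsT, ← integral_indexPathLaw_apply hS hω] at hj
    exact hj

/-- Union bound over the telescoping decomposition of the smoothing error. -/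
theorem measureReal_sampleSmoother_sub_smoothing_le (hA : A.BoundedWith y W Θ)
    (hS : S.MixingWith y a b c G) (hF : A.IsParticleFilter y μ ξ I) {T : ℕ} (s : Fin (T + 1))
    {h : X → ℝ} (hh : Measurable h) {lo o θ ε : ℝ} (ho : 0 ≤ o)
    (hho : ∀ x, h x ∈ Set.Icc lo (lo + o)) (hθ : 0 < θ) (hθ1 : θ < 1) (hθ2 : 1 - a / b ≤ θ ^ 2)
    (hε : 0 < ε) :
    μ.real {ω | ε ≤ |S.sampleSmoother y T s h (A.flow y ξ I ω) T - S.smoothing y T s h|} ≤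
      ∑ t ∈ Finset.range (T + 1),
        hoeffdingBound 2 ((c / (b / a * Θ)) ^ 2 / (8 * (W * (b / a)) ^ 2)) N
          (ε * ((1 - θ) / 2 * θ ^ gap s t)) ((θ ^ 2) ^ gap s t * o) := by
  have hsT : (s : ℕ) ≤ T := by omega
  have h1θ : 0 < 1 - θ := sub_pos.2 hθ1
  let Δ : ℕ → Ω → ℝ := fun t ω => match t with
    | 0 => S.sampleSmoother y T s h (A.flow y ξ I ω) 0 - S.smoothing y T s h
    | t + 1 => S.sampleSmoother y T s h (A.flow y ξ I ω) (t + 1) -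
        S.sampleSmoother y T s h (A.flow y ξ I ω) t
  -- The shares of `ε`: the factor `(1 - θ) / 2` makes each side of `s` contribute at most `1 / 2`.
  let α : ℕ → ℝ := fun t => (1 - θ) / 2 * θ ^ gap s t
  have hα : ∀ t, 0 < ε * α t := fun t => by positivity
  have hαsum : ∑ t ∈ Finset.range (T + 1), α t ≤ 1 := by
    have := sum_gap_le (f := fun k => (1 - θ) / 2 * θ ^ k) (K := 1 / 2) (fun k => by positivity)
      (fun n => by
        rw [← Finset.mul_sum]
        have := mul_le_mul_of_nonneg_left (geom_sum_range_le hθ.le hθ1 n)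
          (by positivity : 0 ≤ (1 - θ) / 2)
        refine this.trans (le_of_eq ?_)
        field_simp) hsT
    linarith
  have htel : ∀ ω, ∑ t ∈ Finset.range (T + 1), Δ t ω =
      S.sampleSmoother y T s h (A.flow y ξ I ω) T - S.smoothing y T s h := by
    intro ω
    rw [Finset.sum_range_succ']
    simp only [Δ]
    rw [Finset.sum_range_sub fun t => S.sampleSmoother y T s h (A.flow y ξ I ω) t]
    ring
  have hstep : ∀ t ∈ Finset.range (T + 1), μ {ω | ε * α t ≤ |Δ t ω|} ≤
      ENNReal.ofReal (hoeffdingBound 2 ((c / (b / a * Θ)) ^ 2 / (8 * (W * (b / a)) ^ 2)) N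
          (ε * α t) ((θ ^ 2) ^ gap s t * o)) := by
    intro t ht
    cases t with
    | zero => exact measure_sampleSmoother_zero_le hA hS hF s hh ho hho hθ2 (hα 0)
    | succ t =>
      exact measure_sampleSmoother_succ_le hA hS hF hsT
        (by have := Finset.mem_range.1 ht; omega) hh ho hho hθ2 (hα (t + 1))
  have hsub : {ω | ε ≤ |S.sampleSmoother y T s h (A.flow y ξ I ω) T - S.smoothing y T s h|} ⊆
      ⋃ t ∈ Finset.range (T + 1), {ω | ε * α t ≤ |Δ t ω|} := by
    intro ω hω
    by_contra hcon
    simp only [Set.mem_iUnion, not_exists] at hcon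
    have hlt : ∀ t ∈ Finset.range (T + 1), |Δ t ω| < ε * α t := fun t ht =>
      not_le.1 (hcon t ht)
    have h1 : |∑ t ∈ Finset.range (T + 1), Δ t ω| < ε := by
      calc _ ≤ ∑ t ∈ Finset.range (T + 1), |Δ t ω| := Finset.abs_sum_le_sum_abs _ _
        _ < ∑ t ∈ Finset.range (T + 1), ε * α t :=
          Finset.sum_lt_sum_of_nonempty (by simp) hlt
        _ = ε * ∑ t ∈ Finset.range (T + 1), α t := by rw [Finset.mul_sum]
        _ ≤ ε * 1 := by gcongr
        _ = ε := mul_one ε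
    rw [htel] at h1
    exact absurd h1 (not_lt.2 hω)
  refine ENNReal.toReal_le_of_le_ofReal
    (Finset.sum_nonneg fun t _ => hoeffdingBound_nonneg zero_le_two _ _ _) ?_
  rw [ENNReal.ofReal_sum_of_nonneg fun t _ => hoeffdingBound_nonneg zero_le_two _ _ _]
  exact (measure_mono hsub).trans ((measure_biUnion_finset_le _ _).trans (Finset.sum_le_sum hstep))

end FilterDesign

theorem osc_nonneg {X : Type*} (h : X → ℝ) : 0 ≤ osc h :=
  Real.iSup_nonneg fun _ => abs_nonneg _

theorem exists_mem_Icc_osc {X : Type*} [Nonempty X] {h : X → ℝ} (hh : ∃ K, ∀ x, |h x| ≤ K) :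
    ∃ lo, ∀ x, h x ∈ Set.Icc lo (lo + osc h) := by
  obtain ⟨K, hK⟩ := hh
  have hbdd : BddBelow (Set.range h) := ⟨-K, by rintro _ ⟨x, rfl⟩; exact (abs_le.1 (hK x)).1⟩
  have hosc : ∀ x x', |h x - h x'| ≤ osc h := fun x x' =>
    le_ciSup (f := fun z : X × X => |h z.1 - h z.2|) ⟨K + K, by
      rintro _ ⟨z, rfl⟩
      exact (abs_sub _ _).trans (add_le_add (hK _) (hK _))⟩ (x, x')
  refine ⟨⨅ x, h x, fun x => ⟨ciInf_le hbdd x, ?_⟩⟩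
  have : h x - osc h ≤ ⨅ x, h x := le_ciInf fun x' => by
    have := (abs_le.1 (hosc x x')).2
    linarith
  linarith

end

end ParticleSmoothing

/-! ### Conclusion -/

theorem mainTheorem3 {X Y : Type*}
    [TopologicalSpace X] [PolishSpace X] [MeasurableSpace X] [BorelSpace X]
    [TopologicalSpace Y] [PolishSpace Y] [MeasurableSpace Y] [BorelSpace Y]
    (S : StateSpaceModel X Y) (A : FilterDesign S) (y : ℕ → Y)
    (hlik : S.BoundedLikelihood y) (hwt : A.BoundedWeights y) (hmix : S.StrongMixing y) :
    ∃ B C : ℝ, 0 < B ∧ 0 < C ∧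
      ∀ (Ω : Type*) [MeasurableSpace Ω] (μ : Measure Ω) [IsProbabilityMeasure μ]
        (N : ℕ) (_ : 1 ≤ N) (ξ : ℕ → Fin N → Ω → X) (I : ℕ → Fin N → Ω → Fin N)
        (_ : A.IsParticleFilter y μ ξ I)
        (T : ℕ) (s : Fin (T + 1)) (h : X → ℝ) (_ : Measurable h) (_ : ∃ K, ∀ x, |h x| ≤ K)
        (ε : ℝ) (_ : 0 < ε),
        μ.real {ω | ε ≤ |A.ffbs y ξ I T s h ω - S.smoothing y T s h|}
            ≤ hoeffdingBound B C N ε (osc h) ∧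
        ∀ J : Fin N → Fin (T + 1) → Ω → Fin N, A.IsBackwardSimulation y μ ξ I T J →
          μ.real {ω | ε ≤ |ffbsi ξ T J s h ω - S.smoothing y T s h|}
            ≤ hoeffdingBound B C N ε (osc h) := by
  obtain ⟨a, b, c, G, hS⟩ := StateSpaceModel.exists_mixingWith hlik hmix
  obtain ⟨W, Θ, hA⟩ := FilterDesign.exists_boundedWith hwt
  have ha := hS.a_pos
  have hb := hS.b_pos
  have hc := hS.c_pos
  have hW := hA.W_pos
  have hΘ : 0 < Θ := one_pos.trans_le hA.one_le
  have hX : Nonempty X := S.χ.nonempty_of_neZero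
  have hab : a / b ≤ 1 := (div_le_one hb).2 hS.a_le_b
  have hab0 : 0 < a / b := div_pos ha hb
  obtain ⟨θ, hθ, hθ1, hθ2⟩ : ∃ θ : ℝ, 0 < θ ∧ θ < 1 ∧ 1 - a / b ≤ θ ^ 2 :=
    -- Squaring gives `1 - a / b` plus a square; unlike `1 - a / b` itself, this `θ` is positive
    -- also when `a = b`.
    ⟨1 - a / b / 2, by linarith, by linarith, by nlinarith⟩
  obtain ⟨B, C, hB, hC, hsum⟩ := exists_sum_hoeffdingBound_le
    (C₀ := (c / (b / a * Θ)) ^ 2 / (8 * (W * (b / a)) ^ 2)) hθ hθ1 (by positivity)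
  have hCm : 0 < min C 2 := lt_min hC two_pos
  -- These come from FFBSi: its error is split into two halves `ε / 2`, whence the `4`, with bounds
  -- of constants `(B, C)` and `(2, 2)`.
  refine ⟨B + 2, min C 2 / 4, by positivity, by positivity, ?_⟩
  intro Ω _ μ _ N hN ξ I hF T s h hh hhb ε hε
  obtain ⟨lo, hlo⟩ := exists_mem_Icc_osc hhb
  have hsT : (s : ℕ) ≤ T := by omega
  have hpos : ∀ᵐ ω ∂μ, ∀ u, 0 < ∑ i, A.weight y ξ I u i ω := ae_all_iff.2 hF.total_pos
  have hmain : ∀ ε : ℝ, 0 < ε →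
      μ.real {ω | ε ≤ |S.sampleSmoother y T s h (A.flow y ξ I ω) T - S.smoothing y T s h|}
        ≤ hoeffdingBound B C N ε (osc h) := fun ε hε =>
    hsum N T s hsT ε (osc h) _ (osc_nonneg h) measureReal_le_one
      (FilterDesign.measureReal_sampleSmoother_sub_smoothing_le hA hS hF s hh
        (osc_nonneg h) hlo hθ hθ1 hθ2 hε)
  refine ⟨?_, fun J hJ => ?_⟩
  · have h1 : μ.real {ω | ε ≤ |A.ffbs y ξ I T s h ω - S.smoothing y T s h|} =
        μ.real {ω | ε ≤ |S.sampleSmoother y T s h (A.flow y ξ I ω) T - S.smoothing y T s h|} := by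
      refine measureReal_congr ?_
      filter_upwards [hpos] with ω hω
      change (ε ≤ _) = (ε ≤ _)
      rw [FilterDesign.ffbs_eq_sampleSmoother hω]
    rw [h1]
    refine (hmain ε hε).trans (hoeffdingBound_mono hB.le (by linarith) ?_ N ε (osc h))
    have := min_le_left C 2
    linarith
  · have hε2 : 0 < ε / 2 := half_pos hε
    have h1 := hmain (ε / 2) hε2
    have h2 : μ.real {ω | ε / 2 ≤ |ffbsi ξ T J s h ω -
        S.sampleSmoother y T s h (A.flow y ξ I ω) T|} ≤ hoeffdingBound 2 2 N (ε / 2) (osc h) :=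
      ENNReal.toReal_le_of_le_ofReal (hoeffdingBound_nonneg zero_le_two _ _ _)
        (FilterDesign.measure_ffbsi_sub_sampleSmoother_le hS hF hN s hJ hh hlo hε2)
    have hsub : {ω | ε ≤ |ffbsi ξ T J s h ω - S.smoothing y T s h|} ⊆
        {ω | ε / 2 ≤ |S.sampleSmoother y T s h (A.flow y ξ I ω) T - S.smoothing y T s h|} ∪
        {ω | ε / 2 ≤ |ffbsi ξ T J s h ω - S.sampleSmoother y T s h (A.flow y ξ I ω) T|} := by
      intro ω hω
      change ε ≤ _ at hω
      change (ε / 2 ≤ _) ∨ (ε / 2 ≤ _)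
      by_contra hcon
      push Not at hcon
      have := abs_sub_le (ffbsi ξ T J s h ω) (S.sampleSmoother y T s h (A.flow y ξ I ω) T)
        (S.smoothing y T s h)
      linarith [hcon.1, hcon.2]
    refine (measureReal_mono hsub).trans ((measureReal_union_le _ _).trans
      ((add_le_add h1 h2).trans ?_))
    have h3 := hoeffdingBound_mono hB.le le_rfl (min_le_left C 2) N (ε / 2) (osc h)
    have h4 := hoeffdingBound_mono zero_le_two le_rfl (min_le_right C 2) N (ε / 2) (osc h)
    refine (add_le_add h3 h4).trans (le_of_eq ?_)
    unfold hoeffdingBound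
    split_ifs
    · simp
    · rw [← add_mul]
      congr 3
      ring
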